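/- **Model.** Let $G=(V,E)$ be a finite simple, undirected, connected graph with $n\ge 2$ nodes, $m$ edges and diameter $D$; at each node $v$ of degree $\delta_v$ the incident edges carry distinct port numbers $0,\dots,\delta_v-1$ (independently at the two endpoints), and $N(v,q)$ is the neighbour of $v$ behind port $q$. A single agent has a state in a finite set $\mathcal M$, and each node $v$ has a whiteboard with content in a finite set $\mathcal W_{\delta_v}$. At each step the agent, being at node $v_{\rm cur}$, reads $\delta_{v_{\rm cur}}$, the port $p_{\rm in}$ through which it arrived, its own state and the whiteboard of $v_{\rm cur}$; it then (possibly at random) updates its state and this whiteboard and moves through a port. A configuration consists of the location of the agent, $p_{\rm in}$, the agent state and all whiteboards. The cover time is the number of moves made before all nodes have been visited (the start node counts as visited). A randomized algorithm is a self-stabilizing exploration algorithm for a class of graphs if on each graph of the class, from every initial configuration, the agent visits all nodes with probability $1$. The memory spaces of the agent and of $v$ are $\log_2|\mathcal M|$ and $\log_2|\mathcal W_{\delta_v}|$ bits. **Algorithm $P_{\rm ran}(c)$**, for an integer $c\ge2$. The agent has a variable $\mathrm{self.color}\in\{1,\dots,c\}$; each node $v$ has variables $v.\mathrm{parent}\in\{\bot,0,\dots,\delta_v-1\}$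 and $v.\mathrm{color}\in\{1,\dots,c\}$. Put $\mathrm{next}(v,q)=(q+1)\bmod\delta_v$. 1. while true: 2. $\quad$ choose $\mathrm{self.color}$ uniformly at random from $\{1,\dots,c\}\setminus\{\mathrm{self.color}\}$ 3. $\quad$ $v_{\rm cur}.\mathrm{color}\gets\mathrm{self.color}$ 4. $\quad$ GoForward$(0)$ 5. $\quad$ while $\neg(v_{\rm cur}.\mathrm{parent}=\bot\ \wedge\ p_{\rm in}=\delta_{v_{\rm cur}}-1\ \wedge\ v_{\rm cur}.\mathrm{color}=\mathrm{self.color})$: 6. $\qquad$ if $v_{\rm cur}.\mathrm{color}\ne\mathrm{self.color}$: 7. $\qquad\quad$ $v_{\rm cur}.\mathrm{color}\gets\mathrm{self.color}$ 8. $\qquad\quad$ $v_{\rm cur}.\mathrm{parent}\gets p_{\rm in}$ 9. $\qquad\quad$ GoForward$(\mathrm{next}(v_{\rm cur},p_{\rm in}))$ 10. $\qquad$ else: 11. $\qquad\quad$ if $v_{\rm cur}.\mathrm{parent}=\mathrm{next}(v_{\rm cur},p_{\rm in})$: 12. $\qquad\qquad$ $v_{\rm cur}.\mathrm{parent}\gets\bot$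 13. $\qquad\qquad$ migrate to $N(v_{\rm cur},\mathrm{next}(v_{\rm cur},p_{\rm in}))$ 14. $\qquad\quad$ else: 15. $\qquad\qquad$ GoForward$(\mathrm{next}(v_{\rm cur},p_{\rm in}))$ 16. function GoForward$(q)$: 17. $\quad$ migrate to $N(v_{\rm cur},q)$ 18. $\quad$ if $v_{\rm cur}.\mathrm{color}=\mathrm{self.color}$: 19. $\qquad$ migrate to $N(v_{\rm cur},p_{\rm in})$ The agent state consists of $\mathrm{self.color}$, the program counter (the line 13, 17 or 19 of the last migration) and the call stack (the line 4, 9 or 15 from which GoForward was called); the whiteboard of $v$ consists of $v.\mathrm{parent}$ and $v.\mathrm{color}$. In an initial configuration all of these, $p_{\rm in}$ and the location of the agent are arbitrary. **Theorem.** There is a universal constant $C$ such that for every integer $c\ge2$ the following hold. * $P_{\rm ran}(c)$ is a randomized self-stabilizing exploration algorithm for all simple, undirected, connected port-labelled graphs. * On every such graph and from every initial configuration, the cover time is at most $C\,mD$ with probability $1$. * On every such graph and from every initial configuration, the expected cover time is at most $$C\cdot\min\Bigl(m\Bigl\lceil \frac{n}{\max(c-n,\;n/D)}\Bigr\rceil,\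 m\Bigl\lceil \frac Dc\Bigr\rceil\log n\Bigr).$$ * The agent memory space is at most $C\log c$ bits, and the memory space of each node $v$ is at most $C(\log c+\log\delta_v)$ bits. -/

import Mathlib

open scoped ENNReal

universe u

/-- A finite, simple, undirected, connected graph with port labels. -/
structure PortGraph where
  V : Type u
  [fintypeV : Fintype V]
  [decEqV : DecidableEq V]
  graph : SimpleGraph V
  [decAdj : DecidableRel graph.Adj]
  connected : graph.Connected
  /-- `port v` numbers the edges incident to `v` (given by their other endpoint)
  bijectively by `0, …, δ_v - 1`. -/
  port : ∀ v, graph.neighborSet v ≃ Fin (graph.degree v)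

attribute [instance] PortGraph.fintypeV PortGraph.decEqV PortGraph.decAdj

namespace PortGraph

/-- The degree `δ_v`. -/
abbrev deg (G : PortGraph.{u}) (v : G.V) : ℕ := G.graph.degree v

/-- The number `n` of nodes. -/
abbrev numNodes (G : PortGraph.{u}) : ℕ := Fintype.card G.V

/-- The number `m` of edges. -/
abbrev numEdges (G : PortGraph.{u}) : ℕ := G.graph.edgeFinset.card

/-- The diameter `D`. -/
noncomputable abbrev diam (G : PortGraph.{u}) : ℕ := G.graph.diam

/-- The `q`-th neighbour `N(v, q)` of `v`. -/
def nbr (G : PortGraph.{u}) (v : G.V) (q : Fin (G.deg v)) : G.V := (G.port v).symm q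

theorem adj_nbr (G : PortGraph.{u}) (v : G.V) (q : Fin (G.deg v)) :
    G.graph.Adj v (G.nbr v q) := ((G.port v).symm q).2

/-- The port number that the edge leaving `v` through port `q` has at its other endpoint. -/
def backPort (G : PortGraph.{u}) (v : G.V) (q : Fin (G.deg v)) : Fin (G.deg (G.nbr v q)) :=
  G.port (G.nbr v q) ⟨v, (G.adj_nbr v q).symm⟩

end PortGraph

/-- A (randomized) algorithm `(φ, M, W)` for a single agent: `M` is the set of agent states,
`W k` is the set of whiteboard states of a node of degree `k`, and `φ` maps the degree of the
current node, the in-port, the agent state and the whiteboard of the current node to a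
distribution of (out-port, new agent state, new whiteboard). -/
structure AgentAlgorithm where
  M : Type
  W : ℕ → Type
  [finiteM : Finite M]
  [finiteW : ∀ k, Finite (W k)]
  φ : (d : ℕ) → Fin d → M → W d → PMF (Fin d × M × W d)

namespace AgentAlgorithm

/-- The agent memory space, in bits. -/
noncomputable def agentMemory (A : AgentAlgorithm) : ℝ := Real.logb 2 (Nat.card A.M)

/-- The whiteboard memory space of a node of degree `d`, in bits. -/
noncomputable def whiteboardMemory (A : AgentAlgorithm) (d : ℕ) : ℝ :=
  Real.logb 2 (Nat.card (A.W d))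

/-- A configuration: the location of the agent, the in-port, the agent state, and the
whiteboards of all nodes. -/
@[ext]
structure Config (A : AgentAlgorithm) (G : PortGraph.{u}) where
  loc : G.V
  pin : Fin (G.deg loc)
  mem : A.M
  wb : ∀ v, A.W (G.deg v)

variable {A : AgentAlgorithm} {G : PortGraph.{u}}

/-- The configuration reached from `γ` by writing `s` to the agent memory and `x` to the
whiteboard of the current node, and then moving through port `q`. -/
def Config.move (γ : Config A G) (q : Fin (G.deg γ.loc)) (s : A.M) (x : A.W (G.deg γ.loc)) :
    Config A G where
  loc := G.nbr γ.loc q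
  pin := G.backPort γ.loc q
  mem := s
  wb := Function.update γ.wb γ.loc x

/-- The distribution of the configuration after one move. -/
noncomputable def Config.step (γ : Config A G) : PMF (Config A G) :=
  (A.φ (G.deg γ.loc) γ.pin γ.mem (γ.wb γ.loc)).map fun r => γ.move r.1 r.2.1 r.2.2

instance : MeasurableSpace (Config A G) := ⊤

/-- The one-step transition kernel of the Markov chain of configurations. -/
noncomputable def stepKernel (A : AgentAlgorithm) (G : PortGraph.{u}) :
    ProbabilityTheory.Kernel (Config A G) (Config A G) where
  toFun γ := γ.step.toMeasure
  measurable' := measurable_from_top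

instance : ProbabilityTheory.IsMarkovKernel (stepKernel A G) :=
  ⟨fun γ => inferInstanceAs (MeasureTheory.IsProbabilityMeasure γ.step.toMeasure)⟩

/-- The transition kernel at time `n` as a kernel of the whole history up to time `n`; it only
depends on the configuration at time `n`. -/
noncomputable def historyKernel (A : AgentAlgorithm) (G : PortGraph.{u}) (n : ℕ) :
    ProbabilityTheory.Kernel (∀ _ : Finset.Iic n, Config A G) (Config A G) :=
  (stepKernel A G).comap (fun h => h ⟨n, Finset.mem_Iic.2 le_rfl⟩) (measurable_pi_apply _)

instance (n : ℕ) : ProbabilityTheory.IsMarkovKernel (historyKernel A G n) :=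
  inferInstanceAs (ProbabilityTheory.IsMarkovKernel ((stepKernel A G).comap _ _))

/-- The law of the execution `ω 0, ω 1, ω 2, …` that starts from the configuration `γ`. -/
noncomputable def execution (γ : Config A G) : MeasureTheory.Measure (ℕ → Config A G) :=
  ProbabilityTheory.Kernel.traj (X := fun _ => Config A G) (historyKernel A G) 0 fun _ => γ

/-- The cover time of a run: the least number `t` of moves such that each node is the location
of the agent at some time `s ≤ t` (`⊤` if there is no such `t`). -/
noncomputable def coverTime (ω : ℕ → Config A G) : ℕ∞ :=
  ⨅ t ∈ {t : ℕ | ∀ v : G.V, ∃ s ≤ t, (ω s).loc = v}, (t : ℕ∞)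

/-- The expected cover time of the execution from `γ`. -/
noncomputable def expectedCoverTime (γ : Config A G) : ℝ≥0∞ :=
  ∫⁻ ω, (coverTime ω : ℝ≥0∞) ∂(execution γ)

/-- `A` is a (randomized) self-stabilizing exploration algorithm for the class `𝒢`: from any
configuration on any graph of `𝒢`, the agent eventually visits all nodes, almost surely. -/
def IsSelfStabilizingExploration (A : AgentAlgorithm) (𝒢 : Set PortGraph.{u}) : Prop :=
  ∀ G ∈ 𝒢, ∀ γ : Config A G, ∀ᵐ ω ∂(execution γ), ∀ v : G.V, ∃ t, (ω t).loc = v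

end AgentAlgorithm

namespace Pran

/-!
The algorithm `P_ran(c)`. Agent variable: `self.color`. Whiteboard variables: `v.parent` and
`v.color`. With `next(v, q) = (q + 1) mod δ_v`, and `cur` the current node, the program is

```
 1  while true
 2    choose self.color uniformly from {1, …, c} minus self.color
 3    cur.color := self.color
 4    GoForward(0)
 5    while not (cur.parent = ⊥ and pin = δ_cur - 1 and cur.color = self.color)
 6      if cur.color ≠ self.color
 7        cur.color := self.color
 8        cur.parent := pin
 9        GoForward(next(cur, pin))
10      else
11        if cur.parent = next(cur, pin)
12          cur.parent := ⊥
13          migrate to N(cur, next(cur, pin))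
14        else
15          GoForward(next(cur, pin))
16  function GoForward(q)
17    migrate to N(cur, q)
18    if cur.color = self.color
19      migrate to N(cur, pin)
```

The conjunct `cur.color = self.color` in line 5 says that a traversal is ended only at a node
that already has the colour of that traversal: a node of another colour is always treated as
unvisited (lines 6-9).
-/

/-- The line from which `GoForward` has been called. -/
inductive Caller
  | line4
  | line9
  | line15
  deriving DecidableEq

instance : Fintype Caller :=
  ⟨{.line4, .line9, .line15}, fun x => by cases x <;> simp⟩

/-- The program counter (the line of the last migration) with the call stack. -/
inductive Counter
  | line13
  | line17 (caller : Caller)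
  | line19 (caller : Caller)
  deriving Fintype

/-- The agent state: `self.color`, program counter and call stack. -/
structure Memory (c : ℕ) where
  color : Fin c
  counter : Counter
  deriving Fintype

/-- The whiteboard of a node of degree `d`; the value `none` of `parent` stands for `⊥`. -/
structure Board (c d : ℕ) where
  parent : Option (Fin d)
  color : Fin c
  deriving Fintype

/-- `next(v, q) = (q + 1) mod δ_v`. -/
def next {d : ℕ} (q : Fin d) : Fin d := ⟨(q + 1) % d, Nat.mod_lt _ q.pos⟩

theorem erase_nonempty {c : ℕ} (hc : 2 ≤ c) (r : Fin c) : (Finset.univ.erase r).Nonempty := by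
  rw [← Finset.card_pos, Finset.card_erase_of_mem (Finset.mem_univ r), Finset.card_univ,
    Fintype.card_fin]
  omega

/-- The computation from the test in line 5 up to the next migration. -/
noncomputable def loopTest {c : ℕ} (hc : 2 ≤ c) (d : ℕ) (pin : Fin d) (self : Memory c)
    (cur : Board c d) : PMF (Fin d × Memory c × Board c d) :=
  if cur.parent = none ∧ (pin : ℕ) = d - 1 ∧ cur.color = self.color then
    (PMF.uniformOfFinset (Finset.univ.erase self.color) (erase_nonempty hc self.color)).map
      fun r => (⟨0, pin.pos⟩, ⟨r, .line17 .line4⟩, ⟨cur.parent, r⟩)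
  else if cur.color ≠ self.color then
    PMF.pure (next pin, ⟨self.color, .line17 .line9⟩, ⟨some pin, self.color⟩)
  else if cur.parent = some (next pin) then
    PMF.pure (next pin, ⟨self.color, .line13⟩, ⟨none, cur.color⟩)
  else
    PMF.pure (next pin, ⟨self.color, .line17 .line15⟩, cur)

/-- The computation of the agent between its arrival at a node and the next migration. -/
noncomputable def transition {c : ℕ} (hc : 2 ≤ c) (d : ℕ) (pin : Fin d) (self : Memory c)
    (cur : Board c d) : PMF (Fin d × Memory c × Board c d) :=
  match self.counter with
  | .line17 caller =>
    if cur.color = self.color then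
      PMF.pure (pin, ⟨self.color, .line19 caller⟩, cur)
    else
      loopTest hc d pin self cur
  | .line13 => loopTest hc d pin self cur
  | .line19 _ => loopTest hc d pin self cur

/-- The algorithm `P_ran(c)`. -/
noncomputable def algorithm (c : ℕ) (hc : 2 ≤ c) : AgentAlgorithm where
  M := Memory c
  W := Board c
  finiteM := inferInstance
  finiteW := fun _ => inferInstance
  φ := transition hc

end Pran

/-! Randomness enters only when a traversal ends and a new colour is drawn; between two draws the
execution is deterministic. A traversal with colour `y` that starts at a root `r` is a depth-first
search of the nodes whose colour is not `y`. Nodes that already have colour `y` act as walls: the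
agent sees them and bounces back. A searched node ends with colour `y` and parent `⊥`, and a
traversal takes `O(m)` moves (`probes`, `traversal_run`). From an arbitrary configuration the
traversal in progress also ends after `O(m)` moves, because a node that has been left for its parent
is cleaned for the rest of it (`exists_run_loopEnd`).

Suppose that a traversal has just ended at `r`, and let `R` be a visited set of nodes of the current
colour `x`, connected to `r` within `R`. The next traversal, with `y ≠ x`, searches a set `A` that
contains `R`, and every neighbour of `A` outside `A` is a wall. Hence `R' = A ∪ N(A)` is visited,
has colour `y` throughout and is connected to `r` (`Grown.traversal`). Since `R'` contains `R` and
its neighbours, every node outside comes closer by at least one, whatever colours are drawn. So `D`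
traversals suffice, which gives `O(mD)`.

For the expectation, fix a node `v` and a shortest walk from `R` to `v`. If `v` is not in the set
`R'` obtained with colour `y`, the walk meets a node of colour `y` in `R'` after some `j ≥ 1` steps,
and the distance to `v` drops by at least `j`. Different colours give different `j`. With the
weights `(c/(c-1))^dist` the expected total weight therefore shrinks by the factor `2/3` in each
traversal (`sum_weight_le`). It is at most `n (c/(c-1))^D` at the beginning, so `O(log n + D/c)`
traversals are expected. If `c > n`, a colour that occurs nowhere is drawn with probability at least
`(c-n)/(c-1)`, and such a traversal has no walls and covers the graph. Both arguments are instances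
of `Supersolution`, which `truncatedCoverTime_le_supersolution` turns into bounds on the cover time.
-/

namespace AgentAlgorithm

/-! ### The law of the cover time: a recursion for its tail probabilities. -/

open MeasureTheory ProbabilityTheory

variable {A : AgentAlgorithm} {G : PortGraph.{u}}

instance : Finite (Config A G) := by
  have := A.finiteM
  have := A.finiteW
  refine Finite.of_injective
    (fun γ : Config A G =>
      ((⟨γ.loc, γ.pin⟩, γ.mem, γ.wb) : (Σ v : G.V, Fin (G.deg v)) × A.M × ∀ v, A.W (G.deg v))) ?_
  rintro ⟨l, p, s, w⟩ ⟨l', p', s', w'⟩ h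
  simp only [Prod.mk.injEq, Sigma.mk.injEq] at h
  obtain ⟨⟨rfl, h⟩, rfl, rfl⟩ := h
  obtain rfl := eq_of_heq h
  rfl

instance : DiscreteMeasurableSpace (Config A G) := ⟨fun _ => trivial⟩

/-- The set of nodes visited by the run `ω` up to time `t`. -/
def visited (ω : ℕ → Config A G) (t : ℕ) : Finset G.V :=
  (Finset.range (t + 1)).image fun s => (ω s).loc

theorem mem_visited {ω : ℕ → Config A G} {t : ℕ} {v : G.V} :
    v ∈ visited ω t ↔ ∃ s ≤ t, (ω s).loc = v := by
  simp [visited]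

theorem visited_succ (ω : ℕ → Config A G) (t : ℕ) :
    visited ω (t + 1) = insert (ω (t + 1)).loc (visited ω t) := by
  rw [visited, Finset.range_add_one, Finset.image_insert, visited]

theorem visited_mono (ω : ℕ → Config A G) : Monotone (visited ω) := fun _ _ h =>
  Finset.image_subset_image (Finset.range_mono (by omega))

theorem visited_eq_of_eqOn {ω ω' : ℕ → Config A G} {t : ℕ} (h : ∀ s ≤ t, ω s = ω' s) :
    visited ω t = visited ω' t := by
  ext v
  simp only [mem_visited]
  exact exists_congr fun s => and_congr_right fun hs => by rw [h s hs]

theorem coverTime_le_iff {ω : ℕ → Config A G} {t : ℕ} :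
    coverTime ω ≤ t ↔ visited ω t = Finset.univ := by
  have key : ∀ s : ℕ, s ∈ {t : ℕ | ∀ v : G.V, ∃ s ≤ t, (ω s).loc = v} ↔
      visited ω s = Finset.univ := by
    intro s
    simp [Finset.eq_univ_iff_forall, mem_visited]
  constructor
  · intro h
    have h' : coverTime ω < ((t + 1 : ℕ) : ℕ∞) :=
      lt_of_le_of_lt h (by exact_mod_cast t.lt_succ_self)
    simp only [coverTime, iInf_lt_iff] at h'
    obtain ⟨s, hs, hst⟩ := h'
    have hst : s ≤ t := Nat.lt_succ_iff.1 (by exact_mod_cast hst)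
    exact Finset.univ_subset_iff.1 ((key s).1 hs ▸ visited_mono ω hst)
  · intro h
    exact iInf₂_le t ((key t).2 h)

/-- `uncovered t γ W` is the probability that some node is neither in `W` nor visited within
`t` moves from `γ`. -/
noncomputable def uncovered : ℕ → Config A G → Finset G.V → ℝ≥0∞
  | 0, _, W => if W = Finset.univ then 0 else 1
  | t + 1, γ, W => ∫⁻ γ', uncovered t γ' (insert γ'.loc W) ∂γ.step.toMeasure

theorem uncovered_univ (t : ℕ) (γ : Config A G) : uncovered t γ Finset.univ = 0 := by
  induction t generalizing γ with
  | zero => simp [uncovered]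
  | succ t ih => simp [uncovered, ih]

theorem uncovered_le_one (t : ℕ) (γ : Config A G) (W : Finset G.V) : uncovered t γ W ≤ 1 := by
  induction t generalizing γ W with
  | zero => simp only [uncovered]; split_ifs <;> simp
  | succ t ih =>
    refine (lintegral_mono fun γ' => ih γ' _).trans ?_
    simp

theorem uncovered_succ_le (t : ℕ) (γ : Config A G) (W : Finset G.V) :
    uncovered (t + 1) γ W ≤ uncovered t γ W := by
  induction t generalizing γ W with
  | zero =>
    by_cases hW : W = Finset.univ
    · subst hW; simp [uncovered_univ]
    · rw [show uncovered 0 γ W = 1 by simp [uncovered, hW]]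
      exact uncovered_le_one _ _ _
  | succ t ih => exact lintegral_mono fun γ' => ih γ' _

theorem uncovered_antitone (γ : Config A G) (W : Finset G.V) :
    Antitone fun t => uncovered t γ W :=
  antitone_nat_of_succ_le fun t => uncovered_succ_le t γ W

theorem uncovered_succ_of_pure {γ γ' : Config A G} (h : γ.step = PMF.pure γ') (t : ℕ)
    (W : Finset G.V) : uncovered (t + 1) γ W = uncovered t γ' (insert γ'.loc W) := by
  rw [uncovered, h, PMF.toMeasure_pure, lintegral_dirac' _ measurable_from_top]

theorem measurable_visited (t : ℕ) :
    @Measurable _ _ _ ⊤ (fun ω : ℕ → Config A G => visited ω t) := by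
  induction t with
  | zero =>
    let _ : MeasurableSpace (Finset G.V) := ⊤
    have : (fun ω : ℕ → Config A G => visited ω 0) = (fun γ => {γ.loc}) ∘ fun ω => ω 0 := by
      funext ω; simp [visited]
    rw [this]
    exact measurable_from_top.comp (measurable_pi_apply 0)
  | succ t ih =>
    let _ : MeasurableSpace (Finset G.V) := ⊤
    have : (fun ω : ℕ → Config A G => visited ω (t + 1)) =
        (fun p : Config A G × Finset G.V => insert p.1.loc p.2) ∘
          fun ω => (ω (t + 1), visited ω t) := by
      funext ω; simp [visited_succ]
    rw [this]
    exact (measurable_of_countable _).comp ((measurable_pi_apply _).prodMk ih)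

theorem measurableSet_visited (t : ℕ) :
    MeasurableSet {ω : ℕ → Config A G | visited ω t ≠ Finset.univ} :=
  measurable_visited t (MeasurableSpace.measurableSet_top (s := {W | W ≠ Finset.univ}))

/-- This is the Markov property: given the history up to time `a`, only `ω a` and the set visited so
far matter. The induction peels off the first remaining move, which is why `a` is arbitrary. -/
theorem lmarginalPartialTraj_visited (k a : ℕ) (ω : ℕ → Config A G) :
    Kernel.lmarginalPartialTraj (X := fun _ => Config A G) (historyKernel A G) a (a + k)
      ({ω | visited ω (a + k) ≠ Finset.univ}.indicator 1) ω =
      uncovered k (ω a) (visited ω a) := by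
  induction k generalizing a ω with
  | zero =>
    rw [Kernel.lmarginalPartialTraj_le _ (by omega)
      (measurable_one.indicator (measurableSet_visited _))]
    by_cases h : visited ω a = Finset.univ <;> simp [uncovered, h]
  | succ k ih =>
    have hm := (measurable_one (α := ℝ≥0∞)).indicator
      (measurableSet_visited (A := A) (G := G) (a + (k + 1)))
    have e : a + (k + 1) = a + 1 + k := by omega
    rw [← Kernel.lmarginalPartialTraj_self (b := a + 1) (by omega) (by omega) hm]
    have h2 : Kernel.lmarginalPartialTraj (X := fun _ => Config A G) (historyKernel A G)
        (a + 1) (a + (k + 1)) ({ω | visited ω (a + (k + 1)) ≠ Finset.univ}.indicator 1) =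
        fun ω => uncovered k (ω (a + 1)) (visited ω (a + 1)) := by
      funext ω
      rw [e]
      exact ih (a + 1) ω
    rw [h2, Kernel.lmarginalPartialTraj_succ]
    · rw [uncovered]
      change ∫⁻ x, _ ∂(stepKernel A G (ω a)) = _
      refine lintegral_congr fun x => ?_
      have : visited (Function.update ω (a + 1) x) a = visited ω a :=
        visited_eq_of_eqOn fun s hs => Function.update_of_ne (by omega) _ _
      rw [visited_succ, this, Function.update_self]
    · let _ : MeasurableSpace (Finset G.V) := ⊤
      exact (measurable_of_countable
        (fun p : Config A G × Finset G.V => uncovered k p.1 p.2)).comp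
        ((measurable_pi_apply (a + 1)).prodMk (measurable_visited (a + 1)))

theorem execution_visited_ne_univ (γ : Config A G) (t : ℕ) :
    execution γ {ω | visited ω t ≠ Finset.univ} = uncovered t γ {γ.loc} := by
  have h := lmarginalPartialTraj_visited t 0 (fun _ : ℕ => γ)
  rw [show visited (fun _ : ℕ => γ) 0 = {γ.loc} by simp [visited]] at h
  rw [← h, ← lintegral_indicator_one (measurableSet_visited t), Kernel.lmarginalPartialTraj,
    zero_add]
  have hf : Preorder.frestrictLe (π := fun _ => Config A G) 0 (fun _ => γ) = fun _ => γ := rfl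
  rw [hf, ← Kernel.traj_map_frestrictLe_apply, lintegral_map, execution]
  · refine lintegral_congr fun ω => ?_
    -- The event depends only on times up to `t`, so the value `γ` that fills the later coordinates
    -- is irrelevant.
    have : visited (Function.updateFinset (fun _ => γ) (Finset.Iic t)
        (Preorder.frestrictLe t ω)) t = visited ω t := by
      refine visited_eq_of_eqOn fun s hs => ?_
      simp [Function.updateFinset, hs]
    by_cases hc : visited ω t = Finset.univ <;> simp [Set.indicator, this, hc]
  · exact (measurable_one.indicator (measurableSet_visited t)).comp measurable_updateFinset
  · fun_prop

theorem ae_coverTime_le {γ : Config A G} {t : ℕ} (h : uncovered t γ {γ.loc} = 0) :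
    ∀ᵐ ω ∂(execution γ), coverTime ω ≤ t := by
  rw [← execution_visited_ne_univ, measure_eq_zero_iff_ae_notMem] at h
  filter_upwards [h] with ω hω
  exact coverTime_le_iff.2 (by simpa using hω)

theorem coverTime_eq_tsum (ω : ℕ → Config A G) :
    (coverTime ω : ℝ≥0∞) =
      ∑' t, {ω | visited ω t ≠ Finset.univ}.indicator (fun _ => (1 : ℝ≥0∞)) ω := by
  have key : ∀ t, {ω | visited ω t ≠ Finset.univ}.indicator (fun _ => (1 : ℝ≥0∞)) ω =
      if coverTime ω ≤ t then 0 else 1 := by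
    intro t
    by_cases h : visited ω t = Finset.univ
    · simp [h, coverTime_le_iff.2 h]
    · simp [h, mt coverTime_le_iff.1 h]
  simp only [key]
  cases hT : coverTime ω with
  | top => simp
  | coe T =>
    rw [tsum_eq_sum (s := Finset.range T)]
    · rw [Finset.sum_congr rfl (g := fun _ => (1 : ℝ≥0∞))]
      · simp
      · intro t ht
        rw [if_neg]
        simpa using ht
    · intro t ht
      rw [if_pos]
      simpa using ht

theorem expectedCoverTime_eq_tsum (γ : Config A G) :
    expectedCoverTime γ = ∑' t, uncovered t γ {γ.loc} := by
  simp only [expectedCoverTime, coverTime_eq_tsum]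
  rw [lintegral_tsum fun t => (measurable_const.indicator (measurableSet_visited t)).aemeasurable]
  refine tsum_congr fun t => ?_
  rw [lintegral_indicator_const (measurableSet_visited t), one_mul, execution_visited_ne_univ]

/-! ### Truncated expectations and deterministic stretches. -/

/-- The expected cover time truncated at `T`, when the nodes of `W` count as visited. -/
noncomputable def truncatedCoverTime (T : ℕ) (γ : Config A G) (W : Finset G.V) : ℝ≥0∞ :=
  ∑ t ∈ Finset.range T, uncovered t γ W

theorem truncatedCoverTime_mono {T T' : ℕ} (h : T ≤ T') (γ : Config A G) (W : Finset G.V) :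
    truncatedCoverTime T γ W ≤ truncatedCoverTime T' γ W :=
  Finset.sum_le_sum_of_subset (Finset.range_mono h)

theorem truncatedCoverTime_univ (T : ℕ) (γ : Config A G) :
    truncatedCoverTime T γ Finset.univ = 0 := by
  simp [truncatedCoverTime, uncovered_univ]

theorem truncatedCoverTime_succ_le (T : ℕ) (γ : Config A G) (W : Finset G.V) :
    truncatedCoverTime (T + 1) γ W ≤
      1 + ∫⁻ γ', truncatedCoverTime T γ' (insert γ'.loc W) ∂γ.step.toMeasure := by
  rw [truncatedCoverTime, Finset.sum_range_succ', add_comm]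
  refine add_le_add (uncovered_le_one _ _ _) (le_of_eq ?_)
  simp only [truncatedCoverTime]
  rw [lintegral_finsetSum _ fun _ _ => measurable_from_top]
  rfl

/-- Truncated times can be bounded by induction on `T`, without knowing beforehand that the
expectation is finite. -/
theorem expectedCoverTime_le_of_truncated {γ : Config A G} {b : ℝ≥0∞}
    (h : ∀ T, truncatedCoverTime T γ {γ.loc} ≤ b) : expectedCoverTime γ ≤ b := by
  rw [expectedCoverTime_eq_tsum]
  exact ENNReal.summable.tsum_le_of_sum_range_le h

/-- `Run k γ W γ' W'`: the first `k` moves from `γ` are deterministic and lead to `γ'`; if the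
nodes of `W` are visited before, then those of `W'` are visited after these moves. -/
inductive Run : ℕ → Config A G → Finset G.V → Config A G → Finset G.V → Prop
  | refl (γ : Config A G) (W : Finset G.V) : Run 0 γ W γ W
  | step {k : ℕ} {γ γ' γ'' : Config A G} {W W' : Finset G.V} (h : γ.step = PMF.pure γ')
      (hr : Run k γ' (insert γ'.loc W) γ'' W') : Run (k + 1) γ W γ'' W'

namespace Run

variable {k l : ℕ} {γ γ' γ'' : Config A G} {W W' W'' : Finset G.V}

theorem single (h : γ.step = PMF.pure γ') : Run 1 γ W γ' (insert γ'.loc W) :=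
  .step h (.refl _ _)

theorem trans (h : Run k γ W γ' W') (h' : Run l γ' W' γ'' W'') : Run (k + l) γ W γ'' W'' := by
  induction h with
  | refl => simpa using h'
  | step hs _ ih =>
    rw [Nat.add_right_comm]
    exact .step hs (ih h')

theorem visited_subset (h : Run k γ W γ' W') : W ⊆ W' := by
  induction h with
  | refl => exact subset_rfl
  | step _ _ ih => exact (Finset.subset_insert _ _).trans ih

theorem loc_mem (h : Run k γ W γ' W') (hγ : γ.loc ∈ W) : γ'.loc ∈ W' := by
  induction h with
  | refl => exact hγ
  | step _ _ ih => exact ih (Finset.mem_insert_self _ _)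

theorem uncovered_add (h : Run k γ W γ' W') (t : ℕ) :
    uncovered (k + t) γ W = uncovered t γ' W' := by
  induction h with
  | refl => simp
  | step hs _ ih => rw [Nat.add_right_comm, uncovered_succ_of_pure hs, ih]

theorem truncatedCoverTime_le (h : Run k γ W γ' W') (T : ℕ) :
    truncatedCoverTime T γ W ≤ k + truncatedCoverTime T γ' W' := by
  induction h with
  | refl => simp
  | @step k γ γ' γ'' W W' hs _ ih =>
    have h1 := (truncatedCoverTime_mono T.le_succ γ W).trans (truncatedCoverTime_succ_le T γ W)
    rw [hs, PMF.toMeasure_pure, lintegral_dirac' _ measurable_from_top] at h1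
    refine h1.trans ?_
    rw [Nat.cast_add, Nat.cast_one, add_comm (k : ℝ≥0∞) 1, add_assoc]
    gcongr

end Run

end AgentAlgorithm

/-! ### Ports and reversal of edges. -/

namespace PortGraph

variable (G : PortGraph.{u})

/-- A node with one of its ports. -/
abbrev Flag : Type u := Σ v : G.V, Fin (G.deg v)

variable {G}

/-- The other end of the edge behind a port. -/
def otherEnd (a : G.Flag) : G.Flag := ⟨G.nbr a.1 a.2, G.backPort a.1 a.2⟩

theorem nbr_port {v w : G.V} (h : G.graph.Adj v w) : G.nbr v (G.port v ⟨w, h⟩) = w := by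
  simp [nbr]

theorem exists_nbr_eq {v w : G.V} (h : G.graph.Adj v w) : ∃ q, G.nbr v q = w :=
  ⟨_, nbr_port h⟩

theorem otherEnd_port {v w : G.V} (h : G.graph.Adj v w) :
    otherEnd (⟨v, G.port v ⟨w, h⟩⟩ : G.Flag) = ⟨w, G.port w ⟨v, h.symm⟩⟩ := by
  have key : ∀ z : G.graph.neighborSet v, z = ⟨w, h⟩ →
      (⟨z.1, G.port z.1 ⟨v, z.2.symm⟩⟩ : G.Flag) = ⟨w, G.port w ⟨v, h.symm⟩⟩ := by
    rintro _ rfl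
    rfl
  exact key _ ((G.port v).symm_apply_apply _)

theorem otherEnd_otherEnd (a : G.Flag) : otherEnd (otherEnd a) = a := by
  obtain ⟨v, q⟩ := a
  obtain ⟨⟨w, h⟩, rfl⟩ := (G.port v).surjective q
  rw [otherEnd_port h, otherEnd_port h.symm]

end PortGraph

/-! ### Rotation of ports and the single moves of the algorithm. -/

namespace Pran

open AgentAlgorithm PortGraph

variable {c : ℕ} {hc : 2 ≤ c} {G : PortGraph.{u}}

theorem next_iterate {d : ℕ} (q : Fin d) (j : ℕ) : (next^[j] q : ℕ) = (q + j) % d := by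
  induction j with
  | zero => simp [Nat.mod_eq_of_lt q.2]
  | succ j ih =>
    rw [Function.iterate_succ_apply']
    simp [next, ih, add_assoc]

/-- A full turn around a node entered through `p`. It also holds for `d = 1`, where the subtraction
truncates and `next` is the identity. -/
theorem next_iterate_sub_two {d : ℕ} (p : Fin d) : next (next^[d - 2] (next p)) = p := by
  rw [← Function.iterate_succ_apply next, ← Function.iterate_succ_apply' next]
  apply Fin.ext
  rw [next_iterate]
  have := p.2
  obtain h | h : d = 1 ∨ 2 ≤ d := by omega
  · subst h; omega
  · rw [show (p : ℕ) + (d - 2 + 1 + 1) = p + d by omega, Nat.add_mod_right, Nat.mod_eq_of_lt p.2]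

theorem exists_next_iterate_eq {d : ℕ} (q p : Fin d) :
    ∃ i < d, next^[i + 1] q = p ∧ ∀ j < i, next^[j + 1] q ≠ p := by
  have hex : ∃ i, next^[i + 1] q = p := by
    refine ⟨p + d - q - 1, Fin.ext ?_⟩
    rw [next_iterate, show (q : ℕ) + (p + d - q - 1 + 1) = p + d by omega, Nat.add_mod_right,
      Nat.mod_eq_of_lt p.2]
  have hlt : ∃ i < d, next^[i + 1] q = p := by
    obtain ⟨i, hi⟩ := hex
    refine ⟨i % d, Nat.mod_lt _ p.pos, ?_⟩
    rw [← hi]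
    apply Fin.ext
    rw [next_iterate, next_iterate]
    exact ((Nat.mod_modEq i _).add_right 1).add_left q
  classical
  obtain ⟨i, hid, hi⟩ := hlt
  exact ⟨Nat.find hex, (Nat.find_min' hex hi).trans_lt hid, Nat.find_spec hex,
    fun j hj => Nat.find_min hex hj⟩

/-- The last port `δ_v - 1`. -/
def lastPort {d : ℕ} (q : Fin d) : Fin d := ⟨d - 1, Nat.sub_lt q.pos one_pos⟩

/-- The counter after a migration in line 13 or 19: the loop test of line 5 comes next. -/
def Counter.IsLoop (k : Counter) : Prop := ∀ caller, k ≠ .line17 caller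

theorem isLoop_line13 : Counter.line13.IsLoop := fun _ => by simp

theorem isLoop_line19 (caller : Caller) : (Counter.line19 caller).IsLoop := fun _ => by simp

/-- All whiteboards of `G`. -/
abbrev Boards (c : ℕ) (G : PortGraph.{u}) : Type u := ∀ v : G.V, Board c (G.deg v)

/-- A configuration of `P_ran(c)` given by its components. -/
def cfg (hc : 2 ≤ c) (a : G.Flag) (x : Fin c) (k : Counter) (b : Boards c G) :
    Config (algorithm c hc) G :=
  ⟨a.1, a.2, (⟨x, k⟩ : Memory c), b⟩

section Step

variable {v : G.V} {q : Fin (G.deg v)} {x : Fin c} {k : Counter} {b : Boards c G}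

theorem step_cfg : (cfg hc ⟨v, q⟩ x k b).step =
    (transition hc (G.deg v) q ⟨x, k⟩ (b v)).map fun r =>
      cfg hc (otherEnd ⟨v, r.1⟩) r.2.1.color r.2.1.counter (Function.update b v r.2.2) := rfl

theorem transition_of_isLoop {d : ℕ} {q : Fin d} {w : Board c d} (hk : k.IsLoop) :
    transition hc d q ⟨x, k⟩ w = loopTest hc d q ⟨x, k⟩ w := by
  cases k with
  | line17 caller => exact absurd rfl (hk caller)
  | line13 => rfl
  | line19 _ => rfl

theorem step_bounce (caller : Caller) (hx : (b v).color = x) :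
    (cfg hc ⟨v, q⟩ x (.line17 caller) b).step =
      PMF.pure (cfg hc (otherEnd ⟨v, q⟩) x (.line19 caller) b) := by
  rw [step_cfg, transition]
  simp only [hx, if_true, PMF.pure_map]
  rw [Function.update_eq_self]

theorem step_visit (hx : (b v).color ≠ x) :
    (cfg hc ⟨v, q⟩ x k b).step =
      PMF.pure (cfg hc (otherEnd ⟨v, next q⟩) x (.line17 .line9)
        (Function.update b v ⟨some q, x⟩)) := by
  have : transition hc (G.deg v) q ⟨x, k⟩ (b v) = loopTest hc (G.deg v) q ⟨x, k⟩ (b v) := by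
    cases k <;> simp [transition, hx]
  rw [step_cfg, this, loopTest]
  simp only [hx, and_false, if_false, ne_eq, not_false_eq_true, if_true, PMF.pure_map]

theorem step_back (hk : k.IsLoop) (hx : (b v).color = x) (hp : (b v).parent = some (next q)) :
    (cfg hc ⟨v, q⟩ x k b).step =
      PMF.pure (cfg hc (otherEnd ⟨v, next q⟩) x .line13 (Function.update b v ⟨none, x⟩)) := by
  rw [step_cfg, transition_of_isLoop hk, loopTest]
  simp only [hx, hp, reduceCtorEq, false_and, if_false, ne_eq, not_true_eq_false, if_true,
    PMF.pure_map]

theorem step_forward (hk : k.IsLoop) (hx : (b v).color = x)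
    (hp : (b v).parent ≠ some (next q)) (hl : (b v).parent = none → (q : ℕ) ≠ G.deg v - 1) :
    (cfg hc ⟨v, q⟩ x k b).step =
      PMF.pure (cfg hc (otherEnd ⟨v, next q⟩) x (.line17 .line15) b) := by
  rw [step_cfg, transition_of_isLoop hk, loopTest]
  have h1 : ¬((b v).parent = none ∧ (q : ℕ) = G.deg v - 1 ∧ (b v).color = x) :=
    fun h => hl h.1 h.2.1
  rw [if_neg h1, if_neg (by simpa using hx), if_neg hp, PMF.pure_map]
  simp only [Function.update_eq_self]

theorem step_restart (hk : k.IsLoop) (hx : (b v).color = x) (hp : (b v).parent = none) :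
    (cfg hc ⟨v, lastPort q⟩ x k b).step =
      (PMF.uniformOfFinset (Finset.univ.erase x) (erase_nonempty hc x)).map fun y =>
        cfg hc (otherEnd ⟨v, ⟨0, q.pos⟩⟩) y (.line17 .line4) (Function.update b v ⟨none, y⟩) := by
  rw [step_cfg, transition_of_isLoop hk, loopTest]
  simp only [hx, hp, lastPort, and_self, if_true, PMF.map_comp]
  rfl

end Step

/-! ### Depth-first search within one traversal. -/

/-- Colour the nodes of `A` by `x` and reset their parents. -/
def paint (x : Fin c) (A : Finset G.V) (b : Boards c G) : Boards c G :=
  fun v => if v ∈ A then ⟨none, x⟩ else b v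

theorem paint_of_mem {x : Fin c} {A : Finset G.V} {b : Boards c G} {v : G.V} (h : v ∈ A) :
    paint x A b v = ⟨none, x⟩ := if_pos h

theorem paint_of_notMem {x : Fin c} {A : Finset G.V} {b : Boards c G} {v : G.V} (h : v ∉ A) :
    paint x A b v = b v := if_neg h

theorem paint_paint (x : Fin c) (A A' : Finset G.V) (b : Boards c G) :
    paint x A' (paint x A b) = paint x (A ∪ A') b := by
  funext v
  by_cases h : v ∈ A <;> by_cases h' : v ∈ A' <;> simp [paint, h, h']

theorem paint_empty (x : Fin c) (b : Boards c G) : paint x ∅ b = b := by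
  funext v; simp [paint]

theorem update_paint (x : Fin c) (A : Finset G.V) (b : Boards c G) (v : G.V) :
    Function.update (paint x A b) v ⟨none, x⟩ = paint x (insert v A) b := by
  funext w
  by_cases h : w = v
  · subst h; simp [paint]
  · simp [paint, h]

/-- The parent stored at `v` during its visit leaves no trace, so a completed search is described by
the set of painted nodes alone. -/
theorem paint_update (x : Fin c) (A : Finset G.V) (b : Boards c G) (v : G.V)
    (w : Board c (G.deg v)) :
    paint x (insert v A) (Function.update b v w) = paint x (insert v A) b := by
  funext u
  by_cases h : u = v
  · subst h; simp [paint]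
  · simp [paint, h]

theorem color_of_color_paint_ne {x : Fin c} {A : Finset G.V} {b : Boards c G} {v : G.V}
    (h : (paint x A b v).color ≠ x) : v ∉ A ∧ (b v).color ≠ x := by
  by_cases hv : v ∈ A
  · simp [paint_of_mem hv] at h
  · exact ⟨hv, by rwa [paint_of_notMem hv] at h⟩

theorem color_paint_eq {x : Fin c} {A : Finset G.V} {b : Boards c G} {v : G.V}
    (h : (paint x A b v).color = x) : v ∈ A ∨ (b v).color = x := by
  by_contra! hv
  exact hv.2 (by rwa [paint_of_notMem hv.1] at h)

/-- The bound for the number of moves charged to the nodes of `A`. -/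
def cost (A : Finset G.V) : ℕ := ∑ v ∈ A, (2 * G.deg v + 1)

/-- A depth-first traversal with colour `x` from the boards `b`, which started from some ports of
`v` and visited the nodes of `W`, has coloured the nodes of `A`. -/
structure Swept (x : Fin c) (b : Boards c G) (v : G.V) (A W : Finset G.V) : Prop where
  fresh : ∀ u ∈ A, (b u).color ≠ x
  closed : ∀ u ∈ A, ∀ w, G.graph.Adj u w → w ∈ A ∨ (b w).color = x
  nbr_mem : ∀ u ∈ A, ∀ w, G.graph.Adj u w → w ∈ W
  subset : A ⊆ W
  span : ∀ B : Finset G.V, v ∈ B → (∀ u ∈ B, ∀ w ∈ A, G.graph.Adj u w → w ∈ B) → A ⊆ B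

namespace Swept

variable {x : Fin c} {b : Boards c G} {v : G.V} {A A' W W' : Finset G.V}

theorem empty (x : Fin c) (b : Boards c G) (v : G.V) (W : Finset G.V) : Swept x b v ∅ W := by
  constructor <;> simp

theorem notMem (h : Swept x b v A W) {u : G.V} (hu : (b u).color = x) : u ∉ A :=
  fun h' => h.fresh u h' hu

/-- Consecutive searches from ports of the same node add up. Connectedness to `v` is phrased in
`span` through sets closed under adjacency, which lets it pass to unions without handling paths. -/
theorem union (h : Swept x b v A W) (h' : Swept x (paint x A b) v A' W') (hW : W ⊆ W') :
    Swept x b v (A ∪ A') W' where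
  fresh u hu := by
    rcases Finset.mem_union.1 hu with hu | hu
    · exact h.fresh u hu
    · exact (color_of_color_paint_ne (h'.fresh u hu)).2
  closed u hu w huw := by
    rw [Finset.mem_union]
    rcases Finset.mem_union.1 hu with hu | hu
    · exact (h.closed u hu w huw).imp_left Or.inl
    · rcases h'.closed u hu w huw with hw | hw
      · exact Or.inl (Or.inr hw)
      · exact (color_paint_eq hw).imp_left Or.inl
  nbr_mem u hu w huw := by
    rcases Finset.mem_union.1 hu with hu | hu
    · exact hW (h.nbr_mem u hu w huw)
    · exact h'.nbr_mem u hu w huw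
  subset := Finset.union_subset (h.subset.trans hW) h'.subset
  span B hv hB := Finset.union_subset
    (h.span B hv fun u hu w hw => hB u hu w (Finset.mem_union_left _ hw))
    (h'.span B hv fun u hu w hw => hB u hu w (Finset.mem_union_right _ hw))

theorem cost_union (h' : Swept x (paint x A b) v A' W') :
    cost (A ∪ A') = cost A + cost A' := by
  refine Finset.sum_union (Finset.disjoint_right.2 fun u hu => ?_)
  exact (color_of_color_paint_ne (h'.fresh u hu)).1

end Swept

/-- The result of probing a port `q` of a node `v` that has the colour `x` of the traversal: the
agent comes back through `q`. -/
def Probes (hc : 2 ≤ c) (x : Fin c) (b : Boards c G) (v : G.V) (q : Fin (G.deg v)) : Prop :=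
  ∀ caller (W : Finset G.V), G.nbr v q ∈ W → ∃ t A k W', k.IsLoop ∧
    Run t (cfg hc (otherEnd ⟨v, q⟩) x (.line17 caller) b) W (cfg hc ⟨v, q⟩ x k (paint x A b)) W' ∧
    Swept x b v A W' ∧ (G.nbr v q ∈ A ∨ (b (G.nbr v q)).color = x) ∧ t ≤ 1 + cost A

/-- The number of nodes whose colour is not `x`. -/
def freshCount (x : Fin c) (b : Boards c G) : ℕ :=
  (Finset.univ.filter fun v : G.V => (b v).color ≠ x).card

theorem freshCount_paint_le (x : Fin c) (A : Finset G.V) (b : Boards c G) :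
    freshCount x (paint x A b) ≤ freshCount x b := by
  refine Finset.card_le_card fun v => ?_
  simp only [Finset.mem_filter, Finset.mem_univ, true_and]
  exact fun h => (color_of_color_paint_ne h).2

theorem freshCount_update_lt {x : Fin c} {b : Boards c G} {v : G.V} (hv : (b v).color ≠ x)
    (p : Option (Fin (G.deg v))) :
    freshCount x (Function.update b v ⟨p, x⟩) < freshCount x b := by
  refine Finset.card_lt_card (Finset.ssubset_iff_subset_ne.2 ⟨fun u => ?_, fun h => ?_⟩)
  · simp only [Finset.mem_filter, Finset.mem_univ, true_and]
    intro hu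
    by_cases huv : u = v
    · subst huv; exact hv
    · rwa [Function.update_of_ne huv] at hu
  · have : v ∈ Finset.univ.filter fun v : G.V => (b v).color ≠ x := by simpa using hv
    rw [← h] at this
    simp at this

/-- The agent probes `i` consecutive ports of `v`, provided that neither the parent port nor the end
of a traversal intervenes. Each port costs two moves plus what the search behind it paints. The
hypothesis `H` is limited to boards with few fresh nodes so that this can be used inside the
induction that proves `probes`. -/
theorem rotate {x : Fin c} {N : ℕ} {v : G.V}
    (H : ∀ b : Boards c G, freshCount x b < N → (b v).color = x → ∀ q, Probes hc x b v q) (i : ℕ)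
    (b : Boards c G) (hN : freshCount x b < N) (hx : (b v).color = x) (q : Fin (G.deg v))
    (hp : ∀ j < i, (b v).parent ≠ some (next^[j + 1] q))
    (hl : (b v).parent = none → ∀ j < i, (next^[j] q : ℕ) ≠ G.deg v - 1)
    (k : Counter) (hk : k.IsLoop) (W : Finset G.V) :
    ∃ t A k' W', k'.IsLoop ∧
      Run t (cfg hc ⟨v, q⟩ x k b) W (cfg hc ⟨v, next^[i] q⟩ x k' (paint x A b)) W' ∧
      Swept x b v A W' ∧
      (∀ j < i, G.nbr v (next^[j + 1] q) ∈ W' ∧ (G.nbr v (next^[j + 1] q) ∈ A ∨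
        (b (G.nbr v (next^[j + 1] q))).color = x)) ∧ t ≤ 2 * i + cost A := by
  induction i generalizing b q k W with
  | zero =>
    exact ⟨0, ∅, k, W, hk, by rw [paint_empty]; exact .refl _ _, .empty _ _ _ _, by simp, by simp⟩
  | succ i ih =>
    have hs := step_forward (hc := hc) hk hx (hp 0 i.succ_pos) fun h => hl h 0 i.succ_pos
    obtain ⟨t₁, A₁, k₁, W₁, hk₁, hr₁, hA₁, hq₁, ht₁⟩ := H b hN hx (next q) .line15
      (insert (G.nbr v (next q)) W) (Finset.mem_insert_self _ _)
    have hv : paint x A₁ b v = b v := paint_of_notMem (hA₁.notMem hx)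
    obtain ⟨t₂, A₂, k₂, W₂, hk₂, hr₂, hA₂, hq₂, ht₂⟩ := ih (paint x A₁ b)
      ((freshCount_paint_le _ _ _).trans_lt hN) (by rwa [hv]) (next q)
      (fun j hj => by rw [hv]; exact hp (j + 1) (by omega))
      (fun h j hj => hl (by rwa [hv] at h) (j + 1) (by omega)) k₁ hk₁ W₁
    have hW := hr₂.visited_subset
    refine ⟨t₁ + 1 + t₂, A₁ ∪ A₂, k₂, W₂, hk₂, ?_, hA₁.union hA₂ hW, ?_, ?_⟩
    · rw [← paint_paint]
      exact (Run.step hs hr₁).trans hr₂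
    · intro j hj
      rcases j with _ | j
      · refine ⟨hW (hr₁.visited_subset (Finset.mem_insert_self _ _)), ?_⟩
        exact hq₁.imp_left (Finset.mem_union_left _)
      · obtain ⟨h1, h2⟩ := hq₂ j (by omega)
        refine ⟨h1, ?_⟩
        rcases h2 with h2 | h2
        · exact Or.inl (Finset.mem_union_right _ h2)
        · exact (color_paint_eq h2).imp_left (Finset.mem_union_left _)
    · rw [hA₂.cost_union]
      omega

theorem exists_iterate_of_adj {v w : G.V} (h : G.graph.Adj v w) (p : Fin (G.deg v)) :
    G.nbr v p = w ∨ G.nbr v (next p) = w ∨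
      ∃ j < G.deg v - 2, G.nbr v (next^[j + 1] (next p)) = w := by
  obtain ⟨q, rfl⟩ := exists_nbr_eq h
  obtain ⟨i, hi, rfl, -⟩ := exists_next_iterate_eq p q
  rcases i with _ | i
  · exact Or.inr (Or.inl rfl)
  · by_cases hi' : i < G.deg v - 2
    · exact Or.inr (Or.inr ⟨i, hi', rfl⟩)
    · left
      congr 1
      obtain rfl : i = G.deg v - 2 := by omega
      rw [Function.iterate_succ_apply', Function.iterate_succ_apply, next_iterate_sub_two]

/-- Entering `v` makes it non-fresh, so `H` applies to everything that happens until the agent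
leaves through `p`. Nothing is assumed about the node behind `p`, because in an arbitrary initial
configuration it need not have colour `x`; hence the separate alternative for it. -/
theorem visit_run {x : Fin c} {v : G.V} (b : Boards c G)
    (H : ∀ b' : Boards c G, freshCount x b' < freshCount x b → (b' v).color = x →
      ∀ q, Probes hc x b' v q)
    (hx : (b v).color ≠ x) (p : Fin (G.deg v)) (k : Counter) (W : Finset G.V) :
    ∃ t A W', Run t (cfg hc ⟨v, p⟩ x k b) W
        (cfg hc (otherEnd ⟨v, p⟩) x .line13 (paint x (insert v A) b)) W' ∧
      Swept x (Function.update b v ⟨some p, x⟩) v A W' ∧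
      (∀ w, G.graph.Adj v w → w ∈ W' ∧ (w = G.nbr v p ∨ w ∈ A ∨ (b w).color = x)) ∧
      v ∉ A ∧ t ≤ cost (insert v A) := by
  have hs := step_visit (hc := hc) (k := k) (q := p) hx
  set b' : Boards c G := Function.update b v ⟨some p, x⟩ with hb'
  have hN : freshCount x b' < freshCount x b := freshCount_update_lt hx _
  have hb'v : b' v = ⟨some p, x⟩ := Function.update_self ..
  have hx' : (b' v).color = x := by rw [hb'v]
  obtain ⟨t₁, A₁, k₁, W₁, hk₁, hr₁, hA₁, hq₁, ht₁⟩ := H b' hN hx' (next p) .line9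
    (insert (G.nbr v (next p)) W) (Finset.mem_insert_self _ _)
  have hv₁ : paint x A₁ b' v = b' v := paint_of_notMem (hA₁.notMem hx')
  -- After the first probe, `deg v - 2` further ports precede `p`. A leaf probes the port `p` itself
  -- and then goes back through it: three moves of its own, which is where `cost` needs `2 * deg +
  -- 1`.
  obtain ⟨t₂, A₂, k₂, W₂, hk₂, hr₂, hA₂, hq₂, ht₂⟩ := rotate H (G.deg v - 2) (paint x A₁ b')
    ((freshCount_paint_le _ _ _).trans_lt hN) (by rwa [hv₁]) (next p)
    (fun j hj h => by
      rw [hv₁, hb'v] at h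
      have h2 : (p : ℕ) = (p + (j + 1 + 1)) % G.deg v := by
        rw [← next_iterate]
        exact congrArg Fin.val (Option.some.inj h)
      have hp := p.2
      rw [← Nat.mod_eq_of_lt hp] at h2
      have h3 : (0 + p) % G.deg v = (j + 1 + 1 + p) % G.deg v := by
        rw [zero_add, h2, Nat.mod_eq_of_lt hp, add_comm]
      have h4 : 0 ≡ j + 1 + 1 [MOD G.deg v] := Nat.ModEq.add_right_cancel' _ h3
      -- The rotation would have to pass a multiple of `deg v` ports, but `0 < j + 2 < deg v`.
      have h5 := (Nat.modEq_zero_iff_dvd.1 h4.symm)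
      have := Nat.le_of_dvd (by omega) h5
      omega)
    (fun h => by simp [hv₁, hb'v] at h) k₁ hk₁ W₁
  rw [paint_paint] at hr₂
  have hA := hA₁.union hA₂ hr₂.visited_subset
  have hvA : v ∉ A₁ ∪ A₂ := hA.notMem hx'
  have hv₂ : paint x (A₁ ∪ A₂) b' v = b' v := paint_of_notMem hvA
  have hs₃ := step_back (hc := hc) (x := x) (k := k₂) (q := next^[G.deg v - 2] (next p))
    (b := paint x (A₁ ∪ A₂) b') hk₂ (by rwa [hv₂])
    (by rw [hv₂, hb'v, next_iterate_sub_two])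
  rw [next_iterate_sub_two, update_paint, hb', paint_update] at hs₃
  have hr := (Run.step hs hr₁).trans (hr₂.trans (Run.single hs₃ (W := W₂)))
  refine ⟨_, A₁ ∪ A₂, _, hr, ?_, ?_, hvA, ?_⟩
  · exact { hA with
      nbr_mem := fun u hu w huw => Finset.mem_insert_of_mem (hA.nbr_mem u hu w huw)
      subset := hA.subset.trans (Finset.subset_insert _ _) }
  · intro w hw
    have hcol : ∀ z, G.graph.Adj v z → (b' z).color = x → (b z).color = x := by
      intro z hz h
      rwa [hb', Function.update_of_ne hz.ne'] at h
    rcases exists_iterate_of_adj hw p with h | h | ⟨j, hj, h⟩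
    · subst h
      exact ⟨Finset.mem_insert_self _ _, Or.inl rfl⟩
    · subst h
      refine ⟨Finset.mem_insert_of_mem (hr₂.visited_subset
        (hr₁.visited_subset (Finset.mem_insert_self _ _))), Or.inr ?_⟩
      exact hq₁.imp (Finset.mem_union_left _) (hcol _ hw)
    · subst h
      obtain ⟨h1, h2⟩ := hq₂ j hj
      refine ⟨Finset.mem_insert_of_mem h1, Or.inr ?_⟩
      rcases h2 with h2 | h2
      · exact Or.inl (Finset.mem_union_right _ h2)
      · exact (color_paint_eq h2).imp (Finset.mem_union_left _) (hcol _ hw)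
  · rw [cost, Finset.sum_insert hvA, ← cost, hA₂.cost_union]
    have := p.pos
    omega

/-- Strong induction on the number of fresh nodes. Behind the port there is either a wall, and the
agent bounces, or a fresh node, whose visit recurses on boards with fewer fresh nodes. -/
theorem probes (x : Fin c) (b : Boards c G) (v : G.V) (hx : (b v).color = x)
    (q : Fin (G.deg v)) : Probes hc x b v q := by
  induction hN : freshCount x b using Nat.strong_induction_on generalizing b v q with
  | _ N ih =>
    subst hN
    intro caller W hW
    by_cases hw : (b (G.nbr v q)).color = x
    · have hs := step_bounce (hc := hc) (q := G.backPort v q) caller hw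
      have hr := Run.single hs (W := W)
      have e : otherEnd ⟨G.nbr v q, G.backPort v q⟩ = ⟨v, q⟩ := otherEnd_otherEnd (⟨v, q⟩ : G.Flag)
      rw [e] at hr
      exact ⟨1, ∅, _, _, isLoop_line19 caller, by rwa [paint_empty], .empty _ _ _ _, Or.inr hw,
        by simp⟩
    · obtain ⟨t, A, W', hr, hA, hadj, hvA, ht⟩ := visit_run (hc := hc) b
        (fun b' hb' hx' q' => ih _ hb' b' _ hx' q' rfl) hw (G.backPort v q) (.line17 caller) W
      have e : otherEnd ⟨G.nbr v q, G.backPort v q⟩ = ⟨v, q⟩ := otherEnd_otherEnd (⟨v, q⟩ : G.Flag)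
      have e' : G.nbr (G.nbr v q) (G.backPort v q) = v := congrArg Sigma.fst e
      have hcol : ∀ z, z ≠ G.nbr v q → (Function.update b (G.nbr v q)
          ⟨some (G.backPort v q), x⟩ z) = b z := fun z hz => Function.update_of_ne hz _ _
      rw [e] at hr
      refine ⟨t, insert (G.nbr v q) A, _, W', isLoop_line13, hr, ?_,
        Or.inl (Finset.mem_insert_self _ _), by omega⟩
      constructor
      · intro u hu
        rcases Finset.mem_insert.1 hu with rfl | hu
        · exact hw
        · have := hA.fresh u hu
          rwa [hcol u (by rintro rfl; exact hvA hu)] at this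
      · intro u hu w huw
        rw [Finset.mem_insert]
        rcases Finset.mem_insert.1 hu with rfl | hu
        · rcases (hadj w huw).2 with h | h | h
          · rw [h, e']; exact Or.inr hx
          · exact Or.inl (Or.inr h)
          · exact Or.inr h
        · rcases hA.closed u hu w huw with h | h
          · exact Or.inl (Or.inr h)
          · by_cases hwv : w = G.nbr v q
            · exact Or.inl (Or.inl hwv)
            · rw [hcol w hwv] at h
              exact Or.inr h
      · intro u hu w huw
        rcases Finset.mem_insert.1 hu with rfl | hu
        · exact (hadj w huw).1
        · exact hA.nbr_mem u hu w huw
      · exact Finset.insert_subset (hr.visited_subset hW) hA.subset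
      · intro B hv hB
        have h1 := hB v hv _ (Finset.mem_insert_self _ _) (G.adj_nbr v q)
        exact Finset.insert_subset h1 (hA.span B h1 fun u hu w hw =>
          hB u hu w (Finset.mem_insert_of_mem hw))

end Pran

/-! ### Linear bounds for the cost of a traversal. -/

namespace PortGraph

variable {G : PortGraph.{u}}

/-- A configuration contains an in-port, so a graph with a single node has none and `n ≥ 2` comes
for free. -/
theorem nontrivial_of_port {v : G.V} (q : Fin (G.deg v)) : Nontrivial G.V :=
  ⟨v, G.nbr v q, (G.adj_nbr v q).ne⟩

theorem card_le_two_mul_numEdges [Nontrivial G.V] : G.numNodes ≤ 2 * G.numEdges := by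
  rw [numEdges, ← G.graph.sum_degrees_eq_twice_card_edges, numNodes, ← Finset.card_univ,
    Finset.card_eq_sum_ones]
  exact Finset.sum_le_sum fun v _ => G.connected.preconnected.degree_pos_of_nontrivial v

end PortGraph

namespace Pran

open AgentAlgorithm PortGraph

variable {c : ℕ} {hc : 2 ≤ c} {G : PortGraph.{u}}

theorem cost_mono {A A' : Finset G.V} (h : A ⊆ A') : cost A ≤ cost A' :=
  Finset.sum_le_sum_of_subset h

theorem cost_le [Nontrivial G.V] (A : Finset G.V) : cost A ≤ 6 * G.numEdges := by
  refine (cost_mono (Finset.subset_univ A)).trans ?_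
  have h := G.card_le_two_mul_numEdges
  rw [cost, Finset.sum_add_distrib, ← Finset.mul_sum, G.graph.sum_degrees_eq_twice_card_edges,
    Finset.sum_const, Finset.card_univ, smul_eq_mul, mul_one]
  simp only [numNodes, numEdges] at h ⊢
  omega

/-- One traversal: after the choice of the colour `y`, the agent returns to the root `r`. -/
theorem traversal_run (y : Fin c) (b : Boards c G) (r : G.V) (q : Fin (G.deg r))
    (hy : (b r).color ≠ y) (W : Finset G.V) (hr : r ∈ W) (hW : G.nbr r ⟨0, q.pos⟩ ∈ W) :
    ∃ t A k W', k.IsLoop ∧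
      Run t (cfg hc (otherEnd ⟨r, ⟨0, q.pos⟩⟩) y (.line17 .line4) (Function.update b r ⟨none, y⟩)) W
        (cfg hc ⟨r, lastPort q⟩ y k (paint y A b)) W' ∧
      r ∈ A ∧ Swept y b r A W' ∧ t + 1 ≤ cost A := by
  set b' : Boards c G := Function.update b r ⟨none, y⟩ with hb'
  have hb'r : b' r = ⟨none, y⟩ := Function.update_self ..
  have hx' : (b' r).color = y := by rw [hb'r]
  obtain ⟨t₁, A₁, k₁, W₁, hk₁, hr₁, hA₁, hq₁, ht₁⟩ :=
    probes (hc := hc) y b' r hx' ⟨0, q.pos⟩ .line4 W hW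
  have hv₁ : paint y A₁ b' r = b' r := paint_of_notMem (hA₁.notMem hx')
  obtain ⟨t₂, A₂, k₂, W₂, hk₂, hr₂, hA₂, hq₂, ht₂⟩ := rotate (hc := hc) (x := y) (v := r)
    (fun b _ hx q => probes y b r hx q) (G.deg r - 1) (paint y A₁ b')
    (Nat.lt_succ_self _) (by rwa [hv₁]) ⟨0, q.pos⟩ (fun j _ h => by simp [hv₁, hb'r] at h)
    (fun _ j hj => by
      rw [next_iterate]
      simp only [zero_add]
      rw [Nat.mod_eq_of_lt (by omega)]
      omega) k₁ hk₁ W₁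
  have hlast : next^[G.deg r - 1] (⟨0, q.pos⟩ : Fin (G.deg r)) = lastPort q := by
    apply Fin.ext
    have := q.pos
    rw [next_iterate]
    simp only [zero_add, lastPort]
    exact Nat.mod_eq_of_lt (by omega)
  have hA := hA₁.union hA₂ hr₂.visited_subset
  have hrA : r ∉ A₁ ∪ A₂ := hA.notMem hx'
  have hadj : ∀ w, G.graph.Adj r w → w ∈ W₂ ∧ (w ∈ A₁ ∪ A₂ ∨ (b' w).color = y) := by
    intro w hw
    obtain ⟨p, rfl⟩ := exists_nbr_eq hw
    rw [Finset.mem_union]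
    rcases hp : (p : ℕ) with _ | j
    · obtain rfl : p = ⟨0, q.pos⟩ := Fin.ext hp
      exact ⟨hr₂.visited_subset (hr₁.visited_subset hW), hq₁.imp_left Or.inl⟩
    · have hpj : p = next^[j + 1] ⟨0, q.pos⟩ := by
        apply Fin.ext
        rw [next_iterate, zero_add, ← hp, Nat.mod_eq_of_lt p.2]
      have hlt := p.2
      obtain ⟨h1, h2⟩ := hq₂ j (by omega)
      rw [← hpj] at h1 h2
      refine ⟨h1, ?_⟩
      rcases h2 with h2 | h2
      · exact Or.inl (Or.inr h2)
      · exact (color_paint_eq h2).imp_left Or.inl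
  have hcol : ∀ z, z ≠ r → b' z = b z := fun z hz => Function.update_of_ne hz _ _
  refine ⟨t₁ + t₂, insert r (A₁ ∪ A₂), k₂, W₂, hk₂, ?_, Finset.mem_insert_self _ _, ?_, ?_⟩
  · rw [paint_paint, hlast] at hr₂
    have e : paint y (A₁ ∪ A₂) b' = paint y (insert r (A₁ ∪ A₂)) b := by
      funext u
      by_cases h : u = r
      · subst h
        rw [paint_of_notMem hrA, hb'r, paint_of_mem (Finset.mem_insert_self _ _)]
      · simp [paint, h, hcol u h]
    rw [← e]
    exact hr₁.trans hr₂
  · constructor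
    · intro u hu
      rcases Finset.mem_insert.1 hu with rfl | hu
      · exact hy
      · have := hA.fresh u hu
        rwa [hcol u (fun h => hrA (h ▸ hu))] at this
    · intro u hu w huw
      have h : w ∈ A₁ ∪ A₂ ∨ (b' w).color = y := by
        rcases Finset.mem_insert.1 hu with rfl | hu
        · exact (hadj w huw).2
        · exact hA.closed u hu w huw
      rw [Finset.mem_insert]
      rcases h with h | h
      · exact Or.inl (Or.inr h)
      · by_cases hwr : w = r
        · exact Or.inl (Or.inl hwr)
        · rw [hcol w hwr] at h
          exact Or.inr h
    · intro u hu w huw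
      rcases Finset.mem_insert.1 hu with rfl | hu
      · exact (hadj w huw).1
      · exact hA.nbr_mem u hu w huw
    · exact Finset.insert_subset (hr₂.visited_subset (hr₁.visited_subset hr)) hA.subset
    · intro B hv hB
      exact Finset.insert_subset hv (hA.span B hv fun u hu w hw =>
        hB u hu w (Finset.mem_insert_of_mem hw))
  · rw [cost, Finset.sum_insert hrA, ← cost, hA₂.cost_union]
    have := q.pos
    omega

/-! ### Recovery from an arbitrary configuration. -/

/-- The number of times that a node can still be left for its parent during a traversal with
colour `x`. -/
def rank {d : ℕ} (x : Fin c) (w : Board c d) : ℕ :=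
  if w.color ≠ x then 2 else if w.parent = none then 0 else 1

theorem rank_pos_of_color {d : ℕ} {x : Fin c} {w : Board c d} (h : w.color ≠ x) :
    0 < rank x w := by
  simp [rank, h]

theorem rank_le_two {d : ℕ} (x : Fin c) (w : Board c d) : rank x w ≤ 2 := by
  rw [rank]; split_ifs <;> omega

/-- A bound for the number of moves until the agent is at a node without parent for good. -/
def potential (x : Fin c) (b : Boards c G) : ℕ := ∑ v, (2 * G.deg v + 1) * rank x (b v)

theorem potential_le (x : Fin c) (b : Boards c G) :
    potential x b ≤ 2 * cost (Finset.univ : Finset G.V) := by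
  rw [potential, cost, Finset.mul_sum]
  exact Finset.sum_le_sum fun v _ => by nlinarith [rank_le_two x (b v)]

/-- Painted nodes drop to rank `0` from at least `1`, so each of them releases its own share of
`cost A`. -/
theorem potential_paint_add_cost_le {x : Fin c} {A : Finset G.V} {b : Boards c G}
    (h : ∀ v ∈ A, 0 < rank x (b v)) : potential x (paint x A b) + cost A ≤ potential x b := by
  have e : cost A = ∑ v, if v ∈ A then 2 * G.deg v + 1 else 0 := by
    rw [cost, Finset.sum_ite_mem, Finset.univ_inter]
  rw [potential, potential, e, ← Finset.sum_add_distrib]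
  refine Finset.sum_le_sum fun v _ => ?_
  by_cases hv : v ∈ A
  · rw [paint_of_mem hv, if_pos hv]
    simp only [rank, ne_eq, not_true_eq_false, if_false, if_true, mul_zero, zero_add]
    exact Nat.le_mul_of_pos_right _ (h v hv)
  · rw [paint_of_notMem hv, if_neg hv, add_zero]

theorem exists_run_loopEnd_aux (x : Fin c) (v : G.V) (q : Fin (G.deg v)) (k : Counter)
    (b : Boards c G) (hk : k.IsLoop ∨ (b v).color ≠ x) (W : Finset G.V) :
    ∃ (t : ℕ) (r : G.V) (q' : Fin (G.deg r)) (k' : Counter) (b' : Boards c G) (W' : Finset G.V),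
      k'.IsLoop ∧ (b' r).color = x ∧ (b' r).parent = none ∧
      Run t (cfg hc ⟨v, q⟩ x k b) W (cfg hc ⟨r, lastPort q'⟩ x k' b') W' ∧
      t ≤ potential x b + cost (Finset.univ : Finset G.V) := by
  induction hN : potential x b using Nat.strong_induction_on generalizing v q k b W with
  | _ N ih =>
    subst hN
    -- Common end of the cases in which the agent leaves `v` for a parent: the moves so far are paid
    -- by the drop of the potential, and the induction continues at the other end of the edge.
    have continue_run : ∀ (t : ℕ) (A W₁ : Finset G.V) (p : Fin (G.deg v)), v ∉ A →
        (∀ u ∈ insert v A, 0 < rank x (b u)) → t ≤ cost (insert v A) →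
        Run t (cfg hc ⟨v, q⟩ x k b) W
          (cfg hc (otherEnd ⟨v, p⟩) x .line13 (paint x (insert v A) b)) W₁ →
        ∃ (t : ℕ) (r : G.V) (q' : Fin (G.deg r)) (k' : Counter) (b' : Boards c G)
          (W' : Finset G.V), k'.IsLoop ∧ (b' r).color = x ∧ (b' r).parent = none ∧
          Run t (cfg hc ⟨v, q⟩ x k b) W (cfg hc ⟨r, lastPort q'⟩ x k' b') W' ∧
          t ≤ potential x b + cost (Finset.univ : Finset G.V) := by
      intro t A W₁ p hvA hrank ht hrun
      have hpot := potential_paint_add_cost_le hrank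
      have hpos : 0 < cost (insert v A) := by
        rw [cost, Finset.sum_insert hvA]
        omega
      obtain ⟨t', r, q', k', b', W', hk', hx', hp', hrun', ht'⟩ :=
        ih _ (by omega) (otherEnd ⟨v, p⟩).1 (otherEnd ⟨v, p⟩).2 .line13
          (paint x (insert v A) b) (Or.inl isLoop_line13) W₁ rfl
      exact ⟨t + t', r, q', k', b', W', hk', hx', hp', hrun.trans hrun', by omega⟩
    by_cases hx : (b v).color = x
    · have hk : k.IsLoop := hk.resolve_right (by simpa using hx)
      rcases hp : (b v).parent with _ | p
      · have hq := q.2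
        have hj : ∀ j ≤ G.deg v - 1 - q, (next^[j] q : ℕ) = q + j := fun j hj => by
          rw [next_iterate, Nat.mod_eq_of_lt (by omega)]
        obtain ⟨t, A, k', W', hk', hrun, hA, -, ht⟩ := rotate (hc := hc) (x := x) (v := v)
          (fun b _ hx q => probes x b v hx q) (G.deg v - 1 - q) b (Nat.lt_succ_self _) hx q
          (fun j _ => by simp [hp]) (fun _ j hj' => by rw [hj j (by omega)]; omega) k hk W
        have hlast : next^[G.deg v - 1 - q] q = lastPort q := by
          apply Fin.ext
          rw [hj _ le_rfl]
          simp only [lastPort]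
          omega
        rw [hlast] at hrun
        have hv : paint x A b v = b v := paint_of_notMem (hA.notMem hx)
        refine ⟨t, v, q, k', _, W', hk', by rwa [hv], by rwa [hv], hrun, ?_⟩
        -- The searches behind the ports are paid by the potential, the turn to the last port by the
        -- extra summand `cost univ`.
        have h1 := potential_paint_add_cost_le fun u hu => rank_pos_of_color (hA.fresh u hu)
        have h2 : 2 * G.deg v + 1 ≤ cost (Finset.univ : Finset G.V) :=
          Finset.single_le_sum (f := fun v => 2 * G.deg v + 1) (fun _ _ => Nat.zero_le _)
            (Finset.mem_univ v)
        omega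
      · obtain ⟨i, hi, hip, hmin⟩ := exists_next_iterate_eq q p
        obtain ⟨t, A, k', W', hk', hrun, hA, -, ht⟩ := rotate (hc := hc) (x := x) (v := v)
          (fun b _ hx q => probes x b v hx q) i b (Nat.lt_succ_self _) hx q
          (fun j hj h => hmin j hj (by rw [hp] at h; exact (Option.some.inj h).symm))
          (fun h => by simp [hp] at h) k hk W
        have hvA := hA.notMem hx
        have hv : paint x A b v = b v := paint_of_notMem hvA
        rw [Function.iterate_succ_apply'] at hip
        have hs := step_back (hc := hc) (x := x) (k := k') (q := next^[i] q) (b := paint x A b) hk'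
          (by rwa [hv]) (by rw [hv, hp, hip])
        rw [hip, update_paint] at hs
        refine continue_run _ A _ p hvA ?_ ?_ (hrun.trans (Run.single hs))
        · intro u hu
          rcases Finset.mem_insert.1 hu with rfl | hu
          · simp [rank, hx, hp]
          · exact rank_pos_of_color (hA.fresh u hu)
        · rw [cost, Finset.sum_insert hvA, ← cost]
          omega
    · obtain ⟨t, A, W', hrun, hA, -, hvA, ht⟩ := visit_run (hc := hc) b
        (fun b' _ hx' q' => probes x b' v hx' q') hx q k W
      refine continue_run t A W' q hvA ?_ ht hrun
      intro u hu
      rcases Finset.mem_insert.1 hu with rfl | hu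
      · exact rank_pos_of_color hx
      · have := hA.fresh u hu
        have huv : u ≠ v := fun h => hvA (h ▸ hu)
        rw [Function.update_of_ne huv] at this
        exact rank_pos_of_color this

/-- From every configuration the agent ends its traversal after a linear number of moves. -/
theorem exists_run_loopEnd (γ : Config (algorithm c hc) G) (W : Finset G.V) :
    ∃ (t : ℕ) (x : Fin c) (r : G.V) (q : Fin (G.deg r)) (k : Counter) (b : Boards c G)
      (W' : Finset G.V), k.IsLoop ∧ (b r).color = x ∧ (b r).parent = none ∧
      Run t γ W (cfg hc ⟨r, lastPort q⟩ x k b) W' ∧ t ≤ 24 * G.numEdges := by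
  obtain ⟨v, q, ⟨x, k⟩, b⟩ := γ
  have := nontrivial_of_port q
  have hcost := cost_le (Finset.univ : Finset G.V)
  have hpos : 0 < cost (Finset.univ : Finset G.V) :=
    Finset.sum_pos (fun _ _ => Nat.succ_pos _) Finset.univ_nonempty
  by_cases hk : k.IsLoop ∨ Board.color (b v) ≠ x
  · obtain ⟨t, r, q', k', b', W', hk', hx', hp', hrun, ht⟩ :=
      exists_run_loopEnd_aux (hc := hc) x v q k b hk W
    have := potential_le x b
    exact ⟨t, x, r, q', k', b', W', hk', hx', hp', hrun, by omega⟩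
  · simp only [Counter.IsLoop, ne_eq, not_or, not_forall, not_not] at hk
    obtain ⟨⟨caller, rfl⟩, hx⟩ := hk
    have hs := step_bounce (hc := hc) (q := q) caller hx
    obtain ⟨t, r, q', k', b', W', hk', hx', hp', hrun, ht⟩ :=
      exists_run_loopEnd_aux (hc := hc) x (otherEnd ⟨v, q⟩).1 (otherEnd ⟨v, q⟩).2 (.line19 caller) b
        (Or.inl (isLoop_line19 _)) (insert (otherEnd ⟨v, q⟩).1 W)
    have := potential_le x b
    exact ⟨t + 1, x, r, q', k', b', W', hk', hx', hp', Run.step hs hrun, by omega⟩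

end Pran

/-! ### Growth of the known region, as a statement about coloured graphs. -/

namespace Pran

open PortGraph

variable {c : ℕ} {G : PortGraph.{u}}

/-- In a traversal with colour `y` of a graph with colouring `κ`, the set `R` of nodes known to be
visited grows at least to `R'`. -/
def Grows (κ : G.V → Fin c) (y : Fin c) (R R' : Finset G.V) : Prop :=
  ∃ A : Finset G.V, R ⊆ A ∧ A ⊆ R' ∧ (∀ u ∈ A, ∀ w, G.graph.Adj u w → w ∈ R') ∧
    ∀ u ∈ A, ∀ w, G.graph.Adj u w → w ∈ A ∨ κ w = y

namespace Grows

variable {κ : G.V → Fin c} {y : Fin c} {R R' : Finset G.V}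

theorem subset (h : Grows κ y R R') : R ⊆ R' := by
  obtain ⟨A, h1, h2, -⟩ := h
  exact h1.trans h2

theorem nbr_mem (h : Grows κ y R R') {u w : G.V} (hu : u ∈ R) (huw : G.graph.Adj u w) :
    w ∈ R' := by
  obtain ⟨A, h1, -, h3, -⟩ := h
  exact h3 u (h1 hu) w huw

/-- The first vertex of the walk outside the searched set `A` is a wall, and as a neighbour of `A`
it belongs to `R'`. -/
theorem exists_getVert (h : Grows κ y R R') {u v : G.V} (hu : u ∈ R) (p : G.graph.Walk u v)
    (hv : v ∉ R') :
    ∃ j, 1 ≤ j ∧ j ≤ p.length ∧ κ (p.getVert j) = y ∧ p.getVert j ∈ R' := by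
  obtain ⟨A, h1, h2, h3, h4⟩ := h
  replace hu := h1 hu
  clear h1
  induction p with
  | nil => exact absurd (h2 hu) hv
  | @cons u w v huw p ih =>
    rcases h4 u hu w huw with hw | hw
    · obtain ⟨j, hj, hjl, hκ, hR⟩ := ih hv hw
      exact ⟨j + 1, by omega, by simpa using hjl, by simpa using hκ, by simpa using hR⟩
    · exact ⟨1, le_rfl, by simp, by simpa using hw, by simpa using h3 u hu w huw⟩

theorem eq_univ (h : Grows κ y R R') (hR : R.Nonempty) (hy : ∀ v, κ v ≠ y) :
    R' = Finset.univ := by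
  obtain ⟨u, hu⟩ := hR
  by_contra hne
  obtain ⟨v, hv⟩ : ∃ v, v ∉ R' := by simpa [Finset.eq_univ_iff_forall] using hne
  obtain ⟨p⟩ := G.connected.preconnected u v
  obtain ⟨j, -, -, hκ, -⟩ := h.exists_getVert hu p hv
  exact hy _ hκ

end Grows

/-- The distance from the set `R` to the node `v`. -/
noncomputable def distTo (R : Finset G.V) (v : G.V) : ℕ :=
  sInf {l | ∃ u ∈ R, ∃ p : G.graph.Walk u v, p.length = l}

theorem distTo_le {R : Finset G.V} {u v : G.V} (hu : u ∈ R) (p : G.graph.Walk u v) :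
    distTo R v ≤ p.length :=
  Nat.sInf_le ⟨u, hu, p, rfl⟩

theorem exists_walk_length_eq_distTo {R : Finset G.V} (hR : R.Nonempty) (v : G.V) :
    ∃ u ∈ R, ∃ p : G.graph.Walk u v, p.length = distTo R v := by
  obtain ⟨u, hu⟩ := hR
  obtain ⟨p⟩ := G.connected.preconnected u v
  exact Nat.sInf_mem (s := {l | ∃ u ∈ R, ∃ p : G.graph.Walk u v, p.length = l})
    ⟨_, u, hu, p, rfl⟩

theorem distTo_le_diam {R : Finset G.V} (hR : R.Nonempty) (v : G.V) : distTo R v ≤ G.diam := by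
  obtain ⟨u, hu⟩ := hR
  obtain ⟨p, hp⟩ := G.connected.exists_walk_length_eq_dist u v
  have : Nonempty G.V := ⟨u⟩
  exact ((distTo_le hu p).trans_eq hp).trans
    (SimpleGraph.dist_le_diam (SimpleGraph.connected_iff_ediam_ne_top.1 G.connected))

theorem Grows.distTo_le_sub_one {κ : G.V → Fin c} {y : Fin c} {R R' : Finset G.V}
    (h : Grows κ y R R') (hR : R.Nonempty) (v : G.V) : distTo R' v ≤ distTo R v - 1 := by
  obtain ⟨u, hu, p, hp⟩ := exists_walk_length_eq_distTo hR v
  rw [← hp]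
  cases p with
  | nil => exact (distTo_le (h.subset hu) .nil)
  | cons huw p => exact (distTo_le (h.nbr_mem hu huw) p)

theorem mem_of_distTo_eq_zero {R : Finset G.V} (hR : R.Nonempty) {v : G.V}
    (h : distTo R v = 0) : v ∈ R := by
  obtain ⟨u, hu, p, hp⟩ := exists_walk_length_eq_distTo hR v
  rw [h] at hp
  exact SimpleGraph.Walk.eq_of_length_eq_zero hp ▸ hu

/-! ### Exponential weights of the unvisited nodes. -/

theorem sum_pow_le_sum_range {z : ℝ} (hz0 : 0 ≤ z) (hz1 : z ≤ 1) (J : Finset ℕ)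
    (hJ : ∀ j ∈ J, 1 ≤ j) : ∑ j ∈ J, z ^ j ≤ ∑ i ∈ Finset.range J.card, z ^ (i + 1) := by
  induction J using Finset.induction_on_max with
  | empty => simp
  | insert M J hM ih =>
    have hMJ : M ∉ J := fun h => lt_irrefl _ (hM M h)
    rw [Finset.sum_insert hMJ, Finset.card_insert_of_notMem hMJ, Finset.sum_range_succ, add_comm]
    refine add_le_add (ih fun j hj => hJ j (Finset.mem_insert_of_mem hj))
      (pow_le_pow_of_le_one hz0 hz1 ?_)
    have hsub : J ⊆ Finset.Ico 1 M := fun j hj =>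
      Finset.mem_Ico.2 ⟨hJ j (Finset.mem_insert_of_mem hj), hM j hj⟩
    have := Finset.card_le_card hsub
    rw [Nat.card_Ico] at this
    have := hJ M (Finset.mem_insert_self _ _)
    omega

/-- The base of the weights, `c / (c - 1)`. -/
noncomputable def weightBase (c : ℕ) : ℝ := c / (c - 1)

theorem weightBase_eq (hc : 2 ≤ c) : weightBase c = 1 / ((c : ℝ) - 1) + 1 := by
  have : (2 : ℝ) ≤ c := by exact_mod_cast hc
  have : (c : ℝ) - 1 ≠ 0 := by linarith
  rw [weightBase]
  field_simp
  ring

theorem one_le_weightBase (hc : 2 ≤ c) : 1 ≤ weightBase c := by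
  have : (2 : ℝ) ≤ c := by exact_mod_cast hc
  rw [weightBase_eq hc]
  have : 0 ≤ 1 / ((c : ℝ) - 1) := div_nonneg zero_le_one (by linarith)
  linarith

/-- For `z = (c-1)/c` one has `z/(1-z) = c-1`, so the sum equals `(c-1)(1 - z^(c-1))`. Moreover
`z^(c-1) ≥ 1/e ≥ 1/3`. The base is chosen so that this gains a constant factor for every `c`. -/
theorem sum_range_inv_weightBase_pow_le (hc : 2 ≤ c) :
    ∑ i ∈ Finset.range (c - 1), (weightBase c)⁻¹ ^ (i + 1) ≤ 2 / 3 * ((c : ℝ) - 1) := by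
  have hc2 : (2 : ℝ) ≤ c := by exact_mod_cast hc
  have hc1 : (0 : ℝ) < (c : ℝ) - 1 := by linarith
  have hcast : ((c - 1 : ℕ) : ℝ) = (c : ℝ) - 1 := by
    rw [Nat.cast_sub (by omega), Nat.cast_one]
  have hpow : weightBase c ^ (c - 1) ≤ 3 := by
    calc weightBase c ^ (c - 1) ≤ Real.exp (1 / ((c : ℝ) - 1)) ^ (c - 1) := by
          refine pow_le_pow_left₀ (zero_le_one.trans (one_le_weightBase hc)) ?_ _
          rw [weightBase_eq hc]
          exact Real.add_one_le_exp _
      _ = Real.exp 1 := by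
          rw [← Real.exp_nat_mul, hcast]
          congr 1
          field_simp
      _ ≤ 3 := by linarith [Real.exp_one_lt_d9]
  have hpos : 0 < weightBase c ^ (c - 1) := pow_pos (by linarith [one_le_weightBase hc]) _
  have hz : (weightBase c)⁻¹ ^ (c - 1) ≥ 1 / 3 := by
    rw [inv_pow, ge_iff_le, one_div]
    exact inv_anti₀ hpos hpow
  have hgeom := mul_neg_geom_sum (weightBase c)⁻¹ (c - 1)
  have hinv : (weightBase c)⁻¹ = ((c : ℝ) - 1) / c := by rw [weightBase, inv_div]
  have hsum : ∑ i ∈ Finset.range (c - 1), (weightBase c)⁻¹ ^ (i + 1) =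
      ((c : ℝ) - 1) * (1 - (weightBase c)⁻¹ ^ (c - 1)) := by
    rw [← hgeom]
    simp_rw [pow_succ']
    rw [← Finset.mul_sum]
    rw [hinv]
    field_simp
    ring
  rw [hsum]
  nlinarith

/-- The weight of the nodes that are not in `R`. -/
noncomputable def weight (c : ℕ) (R : Finset G.V) (v : G.V) : ℝ :=
  if v ∈ R then 0 else weightBase c ^ distTo R v

theorem weight_nonneg (hc : 2 ≤ c) (R : Finset G.V) (v : G.V) : 0 ≤ weight c R v := by
  rw [weight]
  split_ifs
  · exact le_rfl
  · exact pow_nonneg (zero_le_one.trans (one_le_weightBase hc)) _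

/-- All colours are compared along one shortest walk from `R` to `v`. A colour that fails to reach
`v` has a wall at position `j y` of that walk, which divides the weight by at least `weightBase c ^
j y`. A vertex has only one colour, so `j` is injective and the worst case is that the walls occupy
the positions `1, …, c-1`. -/
theorem sum_weight_le (hc : 2 ≤ c) {κ : G.V → Fin c} {x : Fin c} {R : Finset G.V}
    (hR : R.Nonempty) {Rs : Fin c → Finset G.V} (h : ∀ y ≠ x, Grows κ y R (Rs y)) (v : G.V) :
    ∑ y ∈ Finset.univ.erase x, weight c (Rs y) v ≤ 2 / 3 * ((c : ℝ) - 1) * weight c R v := by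
  have hw1 := one_le_weightBase hc
  by_cases hv : v ∈ R
  · rw [weight, if_pos hv, mul_zero]
    refine (Finset.sum_eq_zero fun y hy => ?_).le
    rw [weight, if_pos ((h y (Finset.ne_of_mem_erase hy)).subset hv)]
  obtain ⟨u, hu, p, hp⟩ := exists_walk_length_eq_distTo hR v
  set Y := (Finset.univ.erase x).filter fun y => v ∉ Rs y with hY
  have hYmem : ∀ y ∈ Y, y ≠ x ∧ v ∉ Rs y := fun y hy => by simpa [hY] using hy
  have hex : ∀ y, ∃ j, y ∈ Y →
      1 ≤ j ∧ j ≤ p.length ∧ κ (p.getVert j) = y ∧ p.getVert j ∈ Rs y := by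
    intro y
    by_cases hy : y ∈ Y
    · obtain ⟨j, hj⟩ := (h y (hYmem y hy).1).exists_getVert hu p (hYmem y hy).2
      exact ⟨j, fun _ => hj⟩
    · exact ⟨0, fun h => absurd h hy⟩
  choose j hj using hex
  have hinj : Set.InjOn j Y := fun y hy y' hy' hyy => by
    rw [← (hj y hy).2.2.1, ← (hj y' hy').2.2.1, hyy]
  have h1 : ∑ y ∈ Finset.univ.erase x, weight c (Rs y) v = ∑ y ∈ Y, weight c (Rs y) v := by
    rw [hY, Finset.sum_filter]
    refine Finset.sum_congr rfl fun y _ => ?_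
    by_cases hvy : v ∈ Rs y <;> simp [weight, hvy]
  have h2 : ∀ y ∈ Y, weight c (Rs y) v ≤ weightBase c ^ distTo R v * (weightBase c)⁻¹ ^ j y := by
    intro y hy
    obtain ⟨-, hjl, -, hjR⟩ := hj y hy
    have hd : distTo (Rs y) v ≤ distTo R v - j y := by
      refine (distTo_le hjR (p.drop (j y))).trans_eq ?_
      rw [SimpleGraph.Walk.drop_length, hp]
    have hw0 : weightBase c ≠ 0 := by linarith
    rw [weight, if_neg (hYmem y hy).2, inv_pow, ← pow_sub₀ _ hw0 (hp ▸ hjl)]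
    exact pow_le_pow_right₀ hw1 hd
  rw [h1, weight, if_neg hv]
  refine (Finset.sum_le_sum h2).trans ?_
  rw [← Finset.mul_sum, mul_comm]
  refine mul_le_mul_of_nonneg_right ?_ (pow_nonneg (by linarith) _)
  have hz0 : 0 ≤ (weightBase c)⁻¹ := inv_nonneg.2 (by linarith)
  calc ∑ y ∈ Y, (weightBase c)⁻¹ ^ j y = ∑ i ∈ Y.image j, (weightBase c)⁻¹ ^ i :=
        (Finset.sum_image hinj).symm
    _ ≤ ∑ i ∈ Finset.range (Y.image j).card, (weightBase c)⁻¹ ^ (i + 1) := by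
        refine sum_pow_le_sum_range hz0 (inv_le_one_of_one_le₀ hw1) _ fun i hi => ?_
        obtain ⟨y, hy, rfl⟩ := Finset.mem_image.1 hi
        exact (hj y hy).1
    _ ≤ ∑ i ∈ Finset.range (c - 1), (weightBase c)⁻¹ ^ (i + 1) := by
        refine Finset.sum_le_sum_of_subset_of_nonneg (Finset.range_mono ?_)
          fun i _ _ => pow_nonneg hz0 _
        refine Finset.card_image_le.trans ((Finset.card_filter_le _ _).trans ?_)
        rw [Finset.card_erase_of_mem (Finset.mem_univ x), Finset.card_univ, Fintype.card_fin]
    _ ≤ _ := sum_range_inv_weightBase_pow_le hc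

/-- The total weight of the nodes that are not in `R`. -/
noncomputable def totalWeight (c : ℕ) (R : Finset G.V) : ℝ := ∑ v, weight c R v

theorem one_le_totalWeight (hc : 2 ≤ c) {R : Finset G.V} (hR : R ≠ Finset.univ) :
    1 ≤ totalWeight c R := by
  obtain ⟨v, hv⟩ : ∃ v, v ∉ R := by simpa [Finset.eq_univ_iff_forall] using hR
  refine le_trans ?_ (Finset.single_le_sum (f := weight c R) (fun v _ => weight_nonneg hc R v)
    (Finset.mem_univ v))
  rw [weight, if_neg hv]
  exact one_le_pow₀ (one_le_weightBase hc)

/-! ### Two bounds for the expected number of traversals. -/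

/-- `Ψ R` bounds the expected number of traversals that remain when the nodes of `R` are known to
be visited. -/
structure Supersolution (c : ℕ) (G : PortGraph.{u}) (Ψ : Finset G.V → ℝ) : Prop where
  nonneg : ∀ R, 0 ≤ Ψ R
  le : ∀ (κ : G.V → Fin c) (x : Fin c) (R : Finset G.V) (Rs : Fin c → Finset G.V), R.Nonempty →
    R ≠ Finset.univ → (∀ u ∈ R, κ u = x) → (∀ y ≠ x, Grows κ y R (Rs y)) →
    ∑ y ∈ Finset.univ.erase x, Ψ (Rs y) + ((c : ℝ) - 1) ≤ ((c : ℝ) - 1) * Ψ R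

/-- With total weights `F` before and `F'` after a traversal, `log F' ≤ log F + F'/F - 1`. Averaging
with `E F' ≤ (2/3) F` lowers `3(1 + log F)` by at least one. The summand `1` leaves room for the
value `0` on a covered graph. -/
theorem supersolution_log (hc : 2 ≤ c) :
    Supersolution c G fun R =>
      if R = Finset.univ then 0 else 3 * (1 + Real.log (totalWeight c R)) where
  nonneg R := by
    split_ifs with h
    · exact le_rfl
    · have := Real.log_nonneg (one_le_totalWeight hc h)
      linarith
  le κ x R Rs hR hne _ h := by
    have hF := one_le_totalWeight hc hne
    have hlog := Real.log_nonneg hF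
    have hpt : ∀ y ∈ Finset.univ.erase x,
        (if Rs y = Finset.univ then 0 else 3 * (1 + Real.log (totalWeight c (Rs y)))) ≤
          3 * Real.log (totalWeight c R) +
            3 / totalWeight c R * totalWeight c (Rs y) := by
      intro y _
      split_ifs with hy
      · have : 0 ≤ totalWeight c (Rs y) := Finset.sum_nonneg fun v _ => weight_nonneg hc _ v
        positivity
      · have hFy := one_le_totalWeight hc hy
        have h1 := Real.log_le_sub_one_of_pos
          (div_pos (zero_lt_one.trans_le hFy) (zero_lt_one.trans_le hF))
        rw [Real.log_div (by linarith) (by linarith)] at h1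
        have e : 3 / totalWeight c R * totalWeight c (Rs y) =
            3 * (totalWeight c (Rs y) / totalWeight c R) := by ring
        rw [e]
        linarith
    have hsum : ∑ y ∈ Finset.univ.erase x, totalWeight c (Rs y) ≤
        2 / 3 * ((c : ℝ) - 1) * totalWeight c R := by
      simp only [totalWeight]
      rw [Finset.sum_comm, Finset.mul_sum]
      exact Finset.sum_le_sum fun v _ => sum_weight_le hc hR h v
    have hcard : ((Finset.univ.erase x).card : ℝ) = (c : ℝ) - 1 := by
      rw [Finset.card_erase_of_mem (Finset.mem_univ x), Finset.card_univ, Fintype.card_fin,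
        Nat.cast_sub (by omega), Nat.cast_one]
    have h3 := Finset.sum_le_sum hpt
    rw [Finset.sum_add_distrib, Finset.sum_const, nsmul_eq_mul, hcard, ← Finset.mul_sum] at h3
    have h4 : 3 / totalWeight c R * ∑ y ∈ Finset.univ.erase x, totalWeight c (Rs y) ≤
        2 * ((c : ℝ) - 1) := by
      refine (mul_le_mul_of_nonneg_left hsum (by positivity)).trans_eq ?_
      field_simp
    rw [if_neg hne]
    linarith

theorem totalWeight_singleton_le (hc : 2 ≤ c) (r : G.V) :
    Real.log (totalWeight c ({r} : Finset G.V)) ≤ Real.log G.numNodes + 2 * (G.diam / c) := by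
  have hc2 : (2 : ℝ) ≤ c := by exact_mod_cast hc
  have hn : (0 : ℝ) < G.numNodes := by
    exact_mod_cast Fintype.card_pos_iff.2 ⟨r⟩
  have hw1 := one_le_weightBase hc
  have hw0 : 0 < weightBase c := by linarith
  have hle : totalWeight c ({r} : Finset G.V) ≤ G.numNodes * weightBase c ^ G.diam := by
    have : ∀ v ∈ (Finset.univ : Finset G.V), weight c {r} v ≤ weightBase c ^ G.diam := by
      intro v _
      rw [weight]
      split_ifs
      · positivity
      · exact pow_le_pow_right₀ hw1 (distTo_le_diam (Finset.singleton_nonempty r) v)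
    refine (Finset.sum_le_sum this).trans_eq ?_
    simp
  have hlogw : Real.log (weightBase c) ≤ 2 / c := by
    have h1 := Real.log_le_sub_one_of_pos hw0
    rw [weightBase_eq hc] at h1 ⊢
    refine h1.trans ?_
    rw [add_sub_cancel_right, div_le_div_iff₀ (by linarith) (by linarith)]
    linarith
  have hlog : Real.log (G.numNodes * weightBase c ^ G.diam) ≤
      Real.log G.numNodes + 2 * (G.diam / c) := by
    rw [Real.log_mul hn.ne' (by positivity), Real.log_pow]
    have := mul_le_mul_of_nonneg_left hlogw (Nat.cast_nonneg (α := ℝ) G.diam)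
    calc Real.log G.numNodes + G.diam * Real.log (weightBase c)
        ≤ Real.log G.numNodes + G.diam * (2 / c) := by linarith
      _ = _ := by ring
  -- The total weight vanishes if `r` is the only node; then `Real.log 0 = 0` is harmless.
  by_cases h0 : totalWeight c ({r} : Finset G.V) ≤ 0
  · have : totalWeight c ({r} : Finset G.V) = 0 :=
      le_antisymm h0 (Finset.sum_nonneg fun v _ => weight_nonneg hc _ v)
    rw [this, Real.log_zero]
    have : 0 ≤ Real.log G.numNodes := Real.log_natCast_nonneg _
    positivity
  · exact (Real.log_le_log (not_le.1 h0) hle).trans hlog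

/-- At most `n - 1` colours other than `x` occur, and any other choice finishes. The constant is the
mean of a geometric variable with success probability `(c-n)/(c-1)`. -/
theorem supersolution_unused (hc : 2 ≤ c) (hn : G.numNodes < c) :
    Supersolution c G fun R =>
      if R = Finset.univ then 0 else ((c : ℝ) - 1) / (c - G.numNodes) where
  nonneg R := by
    have hc2 : (2 : ℝ) ≤ c := by exact_mod_cast hc
    have hn' : (G.numNodes : ℝ) < c := by exact_mod_cast hn
    split_ifs
    · exact le_rfl
    · exact div_nonneg (by linarith) (by linarith)
  le κ x R Rs hR hne hx h := by
    have hc2 : (2 : ℝ) ≤ c := by exact_mod_cast hc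
    have hn' : (0 : ℝ) < c - G.numNodes := sub_pos.2 (by exact_mod_cast hn)
    set P := ((c : ℝ) - 1) / (c - G.numNodes) with hP
    have hP0 : 0 ≤ P := div_nonneg (by linarith) hn'.le
    have hPeq : P * (c - G.numNodes) = c - 1 := div_mul_cancel₀ _ hn'.ne'
    obtain ⟨u, hu⟩ := hR
    have hxmem : x ∈ Finset.univ.image κ := Finset.mem_image.2 ⟨u, Finset.mem_univ u, hx u hu⟩
    have hsum : ∑ y ∈ Finset.univ.erase x, (if Rs y = Finset.univ then 0 else P) ≤
        (G.numNodes - 1) * P := by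
      calc ∑ y ∈ Finset.univ.erase x, (if Rs y = Finset.univ then 0 else P)
          = ∑ y ∈ (Finset.univ.image κ).erase x, (if Rs y = Finset.univ then 0 else P) := by
            refine (Finset.sum_subset (Finset.erase_subset_erase _ (Finset.subset_univ _)) ?_).symm
            intro y hy hy'
            have hyx := Finset.ne_of_mem_erase hy
            rw [if_pos]
            refine (h y hyx).eq_univ ⟨u, hu⟩ fun v hv => hy' ?_
            exact Finset.mem_erase.2 ⟨hyx, Finset.mem_image.2 ⟨v, Finset.mem_univ v, hv⟩⟩
        _ ≤ ∑ y ∈ (Finset.univ.image κ).erase x, P :=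
            Finset.sum_le_sum fun y _ => by split_ifs <;> simp [hP0]
        _ = ((Finset.univ.image κ).card - 1 : ℕ) * P := by
            rw [Finset.sum_const, Finset.card_erase_of_mem hxmem, nsmul_eq_mul]
        _ ≤ (G.numNodes - 1) * P := by
            refine mul_le_mul_of_nonneg_right ?_ hP0
            rw [Nat.cast_sub (Finset.card_pos.2 ⟨x, hxmem⟩), Nat.cast_one]
            have : (Finset.univ.image κ).card ≤ G.numNodes := Finset.card_image_le
            have : ((Finset.univ.image κ).card : ℝ) ≤ G.numNodes := by exact_mod_cast this
            linarith
    rw [if_neg hne]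
    nlinarith

end Pran

theorem PMF.lintegral_map_uniformOfFinset {α β : Type*} [Fintype α]
    [MeasurableSpace β] [DiscreteMeasurableSpace β] (s : Finset α) (hs : s.Nonempty) (f : α → β)
    (F : β → ℝ≥0∞) :
    ∫⁻ z, F z ∂((PMF.uniformOfFinset s hs).map f).toMeasure =
      (s.card : ℝ≥0∞)⁻¹ * ∑ y ∈ s, F (f y) := by
  let _ : MeasurableSpace α := ⊤
  rw [← PMF.toMeasure_map (PMF.uniformOfFinset s hs) (f := f) .of_discrete,
    MeasureTheory.lintegral_map .of_discrete .of_discrete,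
    MeasureTheory.lintegral_fintype, Finset.mul_sum, ← Finset.sum_subset (Finset.subset_univ s)]
  · refine Finset.sum_congr rfl fun y hy => ?_
    rw [PMF.toMeasure_apply_singleton _ _ (MeasurableSet.singleton y),
      PMF.uniformOfFinset_apply_of_mem hs hy, mul_comm]
  · intro y _ hy
    rw [PMF.toMeasure_apply_singleton _ _ (MeasurableSet.singleton y),
      PMF.uniformOfFinset_apply_of_notMem hs hy, mul_zero]

/-! ### From traversals to the cover time. -/

namespace Pran

open AgentAlgorithm PortGraph MeasureTheory

variable {c : ℕ} {hc : 2 ≤ c} {G : PortGraph.{u}}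

/-- At the end of a traversal with colour `x` and root `r`, the nodes of `R` have colour `x`, have
been visited, and are connected to `r` within `R`. -/
structure Grown (x : Fin c) (b : Boards c G) (r : G.V) (R W : Finset G.V) : Prop where
  root_mem : r ∈ R
  parent_root : (b r).parent = none
  color_eq : ∀ u ∈ R, (b u).color = x
  subset : R ⊆ W
  span : ∀ B : Finset G.V, r ∈ B → (∀ u ∈ B, ∀ w ∈ R, G.graph.Adj u w → w ∈ B) → R ⊆ B

theorem Grown.singleton {x : Fin c} {b : Boards c G} {r : G.V} {W : Finset G.V}
    (hx : (b r).color = x) (hp : (b r).parent = none) (hr : r ∈ W) : Grown x b r {r} W where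
  root_mem := Finset.mem_singleton_self r
  parent_root := hp
  color_eq u hu := by rw [Finset.mem_singleton.1 hu, hx]
  subset := Finset.singleton_subset_iff.2 hr
  span _ hB _ := Finset.singleton_subset_iff.2 hB

/-- `R` contains no wall and is connected to `r`, so the search swallows it. -/
theorem Grown.traversal {x y : Fin c} {b : Boards c G} {r : G.V} {R W : Finset G.V}
    (h : Grown x b r R W) (q : Fin (G.deg r)) (hy : y ≠ x) :
    ∃ (t : ℕ) (k : Counter) (b' : Boards c G) (R' W' : Finset G.V), k.IsLoop ∧
      Run t (cfg hc (otherEnd ⟨r, ⟨0, q.pos⟩⟩) y (.line17 .line4) (Function.update b r ⟨none, y⟩))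
        (insert (otherEnd ⟨r, ⟨0, q.pos⟩⟩).1 W) (cfg hc ⟨r, lastPort q⟩ y k b') W' ∧
      Grown y b' r R' W' ∧ Grows (fun v => (b v).color) y R R' ∧ t + 1 ≤ 6 * G.numEdges := by
  have := nontrivial_of_port q
  have hfresh : ∀ u ∈ R, (b u).color ≠ y := fun u hu => by
    rw [h.color_eq u hu]; exact hy.symm
  obtain ⟨t, A, k, W', hk, hrun, hrA, hA, ht⟩ := traversal_run (hc := hc) y b r q
    (hfresh r h.root_mem) (insert (otherEnd ⟨r, ⟨0, q.pos⟩⟩).1 W)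
    (Finset.mem_insert_of_mem (h.subset h.root_mem)) (Finset.mem_insert_self _ _)
  have hRA : R ⊆ A := h.span A hrA fun u hu w hw huw =>
    (hA.closed u hu w huw).resolve_right (hfresh w hw)
  classical
  -- The walls around `A` are included: they were visited and already have colour `y`, so the
  -- invariant holds for the larger set.
  let R' : Finset G.V := Finset.univ.filter fun w => w ∈ A ∨ ∃ u ∈ A, G.graph.Adj u w
  have hR' : ∀ w, w ∈ R' ↔ w ∈ A ∨ ∃ u ∈ A, G.graph.Adj u w := fun w => by simp [R']
  refine ⟨t, k, paint y A b, R', W', hk, hrun, ?_, ?_, ht.trans (cost_le A)⟩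
  · constructor
    · exact (hR' r).2 (Or.inl hrA)
    · rw [paint_of_mem hrA]
    · intro w hw
      by_cases hwA : w ∈ A
      · rw [paint_of_mem hwA]
      · obtain ⟨u, hu, huw⟩ := ((hR' w).1 hw).resolve_left hwA
        rw [paint_of_notMem hwA]
        exact (hA.closed u hu w huw).resolve_left hwA
    · intro w hw
      rcases (hR' w).1 hw with hw | ⟨u, hu, huw⟩
      · exact hA.subset hw
      · exact hA.nbr_mem u hu w huw
    · intro B hrB hB
      have hAB := hA.span B hrB fun u hu w hw => hB u hu w ((hR' w).2 (Or.inl hw))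
      intro w hw
      rcases (hR' w).1 hw with hw' | ⟨u, hu, huw⟩
      · exact hAB hw'
      · exact hB u (hAB hu) w hw huw
  · exact ⟨A, hRA, fun w hw => (hR' w).2 (Or.inl hw),
      fun u hu w huw => (hR' w).2 (Or.inr ⟨u, hu, huw⟩), hA.closed⟩

/-- Every possible colour decreases all positive distances, so each term of the average over colours
is zero. -/
theorem uncovered_eq_zero_of_distTo_le {x : Fin c} {b : Boards c G} {r : G.V} {R W : Finset G.V}
    (h : Grown x b r R W) (q : Fin (G.deg r)) {k : Counter} (hk : k.IsLoop) {j : ℕ}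
    (hj : ∀ v, distTo R v ≤ j) :
    uncovered (6 * G.numEdges * j) (cfg hc ⟨r, lastPort q⟩ x k b) W = 0 := by
  induction j generalizing x b R W k with
  | zero =>
    have hW : W = Finset.univ := Finset.eq_univ_iff_forall.2 fun v =>
      h.subset (mem_of_distTo_eq_zero ⟨r, h.root_mem⟩ (Nat.le_zero.1 (hj v)))
    rw [hW, uncovered_univ]
  | succ j ih =>
    have := nontrivial_of_port q
    have hm : 0 < 6 * G.numEdges := by
      have := G.card_le_two_mul_numEdges
      have := Fintype.one_lt_card (α := G.V)
      simp only [numNodes] at *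
      omega
    obtain ⟨T, hT⟩ : ∃ T, 6 * G.numEdges * (j + 1) = T + 1 :=
      ⟨6 * G.numEdges * (j + 1) - 1, (Nat.sub_add_cancel (Nat.mul_pos hm j.succ_pos)).symm⟩
    rw [hT, uncovered, step_restart hk (h.color_eq r h.root_mem) h.parent_root,
      PMF.lintegral_map_uniformOfFinset, Finset.sum_eq_zero, mul_zero]
    intro y hy
    obtain ⟨t, k', b', R', W', hk', hrun, hG, hgrow, ht⟩ :=
      h.traversal (hc := hc) q (Finset.ne_of_mem_erase hy)
    have h0 := ih hG hk' fun v =>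
      (hgrow.distTo_le_sub_one ⟨r, h.root_mem⟩ v).trans (Nat.sub_le_iff_le_add.2 (hj v))
    rw [← hrun.uncovered_add] at h0
    refine le_antisymm ((uncovered_antitone _ _ ?_).trans h0.le) zero_le
    rw [Nat.mul_succ] at hT
    omega

/-- Each traversal costs at most `6m` moves including the restart, and `Ψ` decreases on average by
at least one per traversal until everything is known. -/
theorem truncatedCoverTime_le_supersolution {Ψ : Finset G.V → ℝ} (hΨ : Supersolution c G Ψ)
    (T : ℕ) {x : Fin c} {b : Boards c G} {r : G.V} {R W : Finset G.V}
    (h : Grown x b r R W) (q : Fin (G.deg r)) {k : Counter} (hk : k.IsLoop) :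
    truncatedCoverTime T (cfg hc ⟨r, lastPort q⟩ x k b) W ≤
      ENNReal.ofReal (6 * G.numEdges * Ψ R) := by
  induction T generalizing x b R W k with
  | zero => simp [truncatedCoverTime]
  | succ T ih =>
    by_cases hW : W = Finset.univ
    · rw [hW, truncatedCoverTime_univ]
      exact zero_le
    have hRne : R ≠ Finset.univ := fun hR => hW (Finset.univ_subset_iff.1 (hR ▸ h.subset))
    have hc2 : (2 : ℝ) ≤ c := by exact_mod_cast hc
    -- The `-1` in the bound is the restart move, which is counted separately.
    have hex : ∀ y, ∃ R' : Finset G.V, y ≠ x → Grows (fun v => (b v).color) y R R' ∧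
        truncatedCoverTime T (cfg hc (otherEnd ⟨r, ⟨0, q.pos⟩⟩) y (.line17 .line4)
          (Function.update b r ⟨none, y⟩)) (insert (otherEnd ⟨r, ⟨0, q.pos⟩⟩).1 W) ≤
          ENNReal.ofReal (6 * G.numEdges - 1 + 6 * G.numEdges * Ψ R') := by
      intro y
      by_cases hy : y = x
      · exact ⟨∅, fun h => absurd hy h⟩
      obtain ⟨t, k', b', R', W', hk', hrun, hG, hgrow, ht⟩ := h.traversal (hc := hc) q hy
      refine ⟨R', fun _ => ⟨hgrow, (hrun.truncatedCoverTime_le T).trans ?_⟩⟩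
      have ht' : (t : ℝ) + 1 ≤ 6 * G.numEdges := by exact_mod_cast ht
      have hΨ0 := hΨ.nonneg R'
      rw [ENNReal.ofReal_add (by linarith [Nat.cast_nonneg (α := ℝ) t]) (by positivity)]
      refine add_le_add ?_ (ih hG hk')
      rw [← ENNReal.ofReal_natCast]
      exact ENNReal.ofReal_le_ofReal (by linarith)
    choose Rs hRs using hex
    have hcard : (Finset.univ.erase x).card = c - 1 := by
      rw [Finset.card_erase_of_mem (Finset.mem_univ x), Finset.card_univ, Fintype.card_fin]
    have hcast : ((c - 1 : ℕ) : ℝ) = (c : ℝ) - 1 := by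
      rw [Nat.cast_sub (by omega), Nat.cast_one]
    have := nontrivial_of_port q
    have hm : (1 : ℝ) ≤ G.numEdges := by
      have := G.card_le_two_mul_numEdges
      have := Fintype.one_lt_card (α := G.V)
      simp only [numNodes] at *
      exact_mod_cast (by omega : 1 ≤ G.numEdges)
    have hnn : ∀ y, 0 ≤ 6 * (G.numEdges : ℝ) - 1 + 6 * G.numEdges * Ψ (Rs y) := fun y => by
      have := hΨ.nonneg (Rs y)
      have : 0 ≤ 6 * (G.numEdges : ℝ) * Ψ (Rs y) := by positivity
      linarith
    refine (truncatedCoverTime_succ_le _ _ _).trans ?_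
    rw [step_restart hk (h.color_eq r h.root_mem) h.parent_root,
      PMF.lintegral_map_uniformOfFinset, hcard]
    have hsum : ∑ y ∈ Finset.univ.erase x, truncatedCoverTime T
        (cfg hc (otherEnd ⟨r, ⟨0, q.pos⟩⟩) y (.line17 .line4) (Function.update b r ⟨none, y⟩))
          (insert (otherEnd ⟨r, ⟨0, q.pos⟩⟩).1 W) ≤
        ENNReal.ofReal (∑ y ∈ Finset.univ.erase x,
          (6 * (G.numEdges : ℝ) - 1 + 6 * G.numEdges * Ψ (Rs y))) := by
      rw [ENNReal.ofReal_sum_of_nonneg fun y _ => hnn y]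
      exact Finset.sum_le_sum fun y hy => (hRs y (Finset.ne_of_mem_erase hy)).2
    refine (add_le_add_right (mul_le_mul_right hsum _) _).trans ?_
    have hc1 : (0 : ℝ) < (c : ℝ) - 1 := by linarith
    rw [← ENNReal.ofReal_natCast, hcast, ← ENNReal.ofReal_inv_of_pos hc1,
      ← ENNReal.ofReal_mul (by positivity), ← ENNReal.ofReal_one,
      ← ENNReal.ofReal_add zero_le_one
        (mul_nonneg (by positivity) (Finset.sum_nonneg fun y _ => hnn y))]
    refine ENNReal.ofReal_le_ofReal ?_
    have hle := hΨ.le (fun v => (b v).color) x R Rs ⟨r, h.root_mem⟩ hRne h.color_eq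
      fun y hy => (hRs y hy).1
    rw [Finset.sum_add_distrib, Finset.sum_const, hcard, nsmul_eq_mul, hcast, ← Finset.mul_sum]
    have e : ((c : ℝ) - 1)⁻¹ * (((c : ℝ) - 1) * (6 * (G.numEdges : ℝ) - 1) +
        6 * G.numEdges * ∑ y ∈ Finset.univ.erase x, Ψ (Rs y)) =
        6 * G.numEdges * (((c : ℝ) - 1)⁻¹ *
          (∑ y ∈ Finset.univ.erase x, Ψ (Rs y) + ((c : ℝ) - 1))) - 1 := by
      field_simp
      ring
    rw [e]
    have h2 : ((c : ℝ) - 1)⁻¹ * (∑ y ∈ Finset.univ.erase x, Ψ (Rs y) + ((c : ℝ) - 1)) ≤ Ψ R := by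
      rw [inv_mul_le_iff₀ hc1]
      exact hle
    have h3 := mul_le_mul_of_nonneg_left h2 (by positivity : (0 : ℝ) ≤ 6 * G.numEdges)
    linarith

/-- The execution reaches the end of a traversal after a linear number of moves. -/
theorem exists_run_grown (γ : Config (algorithm c hc) G) :
    ∃ (t : ℕ) (x : Fin c) (r : G.V) (q : Fin (G.deg r)) (k : Counter) (b : Boards c G)
      (W : Finset G.V), k.IsLoop ∧ Grown x b r {r} W ∧
      Run t γ {γ.loc} (cfg hc ⟨r, lastPort q⟩ x k b) W ∧ t ≤ 24 * G.numEdges := by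
  obtain ⟨t, x, r, q, k, b, W, hk, hx, hp, hrun, ht⟩ := exists_run_loopEnd γ {γ.loc}
  exact ⟨t, x, r, q, k, b, W, hk,
    .singleton hx hp (hrun.loc_mem (Finset.mem_singleton_self _)), hrun, ht⟩

theorem expectedCoverTime_le_supersolution {Ψ : Finset G.V → ℝ} (hΨ : Supersolution c G Ψ)
    {B : ℝ} (hB : ∀ r, Ψ {r} ≤ B) (γ : Config (algorithm c hc) G) :
    expectedCoverTime γ ≤ ENNReal.ofReal (G.numEdges * (24 + 6 * B)) := by
  obtain ⟨t, x, r, q, k, b, W, hk, hG, hrun, ht⟩ := exists_run_grown γ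
  refine expectedCoverTime_le_of_truncated fun T => (hrun.truncatedCoverTime_le T).trans ?_
  refine (add_le_add_right (truncatedCoverTime_le_supersolution hΨ T hG q hk) _).trans ?_
  have ht' : (t : ℝ) ≤ 24 * G.numEdges := by exact_mod_cast ht
  have h0 := hΨ.nonneg {r}
  rw [← ENNReal.ofReal_natCast, ← ENNReal.ofReal_add (by positivity) (by positivity)]
  refine ENNReal.ofReal_le_ofReal ?_
  have := mul_le_mul_of_nonneg_left (hB r) (by positivity : (0 : ℝ) ≤ 6 * G.numEdges)
  linarith

/-! ### The bounds in closed form. -/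

theorem diam_pos [Nontrivial G.V] : 0 < G.diam :=
  Nat.pos_of_ne_zero (SimpleGraph.connected_iff_diam_ne_zero.1 G.connected)

theorem ae_coverTime_le_mul_diam (γ : Config (algorithm c hc) G) :
    ∀ᵐ ω ∂(execution γ), coverTime ω ≤ ((30 * (G.numEdges * G.diam) : ℕ) : ℕ∞) := by
  have := nontrivial_of_port γ.pin
  obtain ⟨t, x, r, q, k, b, W, hk, hG, hrun, ht⟩ := exists_run_grown γ
  have h0 := uncovered_eq_zero_of_distTo_le (hc := hc) hG q hk
    fun v => distTo_le_diam (Finset.singleton_nonempty r) v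
  rw [← hrun.uncovered_add] at h0
  refine ae_coverTime_le (le_antisymm ((uncovered_antitone _ _ ?_).trans h0.le) zero_le)
  have := Nat.mul_le_mul_left G.numEdges (Nat.succ_le_of_lt (diam_pos (G := G)))
  rw [mul_assoc]
  omega

theorem expectedCoverTime_le_mul_diam (γ : Config (algorithm c hc) G) :
    expectedCoverTime γ ≤ ENNReal.ofReal (30 * (G.numEdges * G.diam)) := by
  have hprob : IsProbabilityMeasure (execution γ) := by
    rw [execution]
    infer_instance
  have h : ∀ᵐ ω ∂(execution γ),
      (coverTime ω : ℝ≥0∞) ≤ ENNReal.ofReal (30 * (G.numEdges * G.diam)) := by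
    filter_upwards [ae_coverTime_le_mul_diam γ] with ω hω
    refine (ENat.toENNReal_le.2 hω).trans_eq ?_
    rw [ENat.toENNReal_coe, ← ENNReal.ofReal_natCast]
    push_cast
    rfl
  refine (lintegral_mono_ae h).trans ?_
  simp

theorem expectedCoverTime_le_unused (γ : Config (algorithm c hc) G) :
    expectedCoverTime γ ≤ ENNReal.ofReal (200 * (G.numEdges *
      (⌈(G.numNodes : ℝ) / max ((c : ℝ) - G.numNodes) ((G.numNodes : ℝ) / G.diam)⌉ : ℝ))) := by
  have := nontrivial_of_port γ.pin
  have hn : (0 : ℝ) < G.numNodes := by exact_mod_cast Fintype.card_pos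
  have hD : (0 : ℝ) < G.diam := by exact_mod_cast diam_pos (G := G)
  rcases le_or_gt ((c : ℝ) - G.numNodes) ((G.numNodes : ℝ) / G.diam) with h | h
  -- Here the quotient is exactly `D`, and the almost sure bound suffices.
  · rw [max_eq_right h, div_div_cancel₀ hn.ne']
    refine (expectedCoverTime_le_mul_diam γ).trans (ENNReal.ofReal_le_ofReal ?_)
    rw [Int.ceil_natCast, Int.cast_natCast]
    have : 0 ≤ (G.numEdges : ℝ) * G.diam := by positivity
    linarith
  · have hpos : 0 < (c : ℝ) - G.numNodes := (div_pos hn hD).trans h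
    have hnc : G.numNodes < c := by exact_mod_cast sub_pos.1 hpos
    rw [max_eq_left h.le]
    refine (expectedCoverTime_le_supersolution (supersolution_unused hc hnc)
      (B := ((c : ℝ) - 1) / (c - G.numNodes)) (fun r => ?_) γ).trans (ENNReal.ofReal_le_ofReal ?_)
    · split_ifs
      · have : (2 : ℝ) ≤ c := by exact_mod_cast hc
        exact div_nonneg (by linarith) hpos.le
      · exact le_rfl
    · have h1 : ((c : ℝ) - 1) / (c - G.numNodes) ≤ 1 + G.numNodes / (c - G.numNodes) := by
        rw [div_le_iff₀ hpos, add_mul, div_mul_cancel₀ _ hpos.ne']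
        linarith
      have h2 := Int.le_ceil ((G.numNodes : ℝ) / (c - G.numNodes))
      have h3 : (1 : ℝ) ≤ (⌈(G.numNodes : ℝ) / (c - G.numNodes)⌉ : ℝ) := by
        exact_mod_cast Int.one_le_ceil_iff.2 (div_pos hn hpos)
      have hm : (0 : ℝ) ≤ G.numEdges := Nat.cast_nonneg _
      rw [mul_left_comm]
      refine mul_le_mul_of_nonneg_left ?_ hm
      linarith

theorem expectedCoverTime_le_log (γ : Config (algorithm c hc) G) :
    expectedCoverTime γ ≤ ENNReal.ofReal (200 *
      (G.numEdges * (⌈(G.diam : ℝ) / c⌉ : ℝ) * Real.log G.numNodes)) := by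
  have := nontrivial_of_port γ.pin
  have hc2 : (2 : ℝ) ≤ c := by exact_mod_cast hc
  have hn : (2 : ℝ) ≤ G.numNodes := by exact_mod_cast Fintype.one_lt_card (α := G.V)
  have hD : (0 : ℝ) < G.diam := by exact_mod_cast diam_pos (G := G)
  have hL : (0.69 : ℝ) ≤ Real.log G.numNodes := by
    have := Real.log_le_log (by norm_num) hn
    linarith [Real.log_two_gt_d9]
  refine (expectedCoverTime_le_supersolution (supersolution_log hc)
    (B := 3 * (1 + (Real.log G.numNodes + 2 * (G.diam / c)))) (fun r => ?_) γ).trans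
    (ENNReal.ofReal_le_ofReal ?_)
  · split_ifs
    · positivity
    · linarith [totalWeight_singleton_le (G := G) hc r]
  · have h2 := Int.le_ceil ((G.diam : ℝ) / c)
    have h3 : (1 : ℝ) ≤ (⌈(G.diam : ℝ) / c⌉ : ℝ) := by
      exact_mod_cast Int.one_le_ceil_iff.2 (div_pos hD (by linarith))
    have hm : (0 : ℝ) ≤ G.numEdges := Nat.cast_nonneg _
    rw [mul_assoc (G.numEdges : ℝ), mul_left_comm 200]
    refine mul_le_mul_of_nonneg_left ?_ hm
    have h4 := mul_le_mul_of_nonneg_right h3 (by linarith : 0 ≤ Real.log G.numNodes)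
    have h5 := mul_le_mul_of_nonneg_left hL (by linarith : 0 ≤ (⌈(G.diam : ℝ) / c⌉ : ℝ))
    linarith

/-! ### Memory space. -/

theorem agentMemory_le (hc : 2 ≤ c) : (algorithm c hc).agentMemory ≤ 200 * Real.logb 2 c := by
  have hinj : Function.Injective fun s : Memory c => (s.color, s.counter) := by
    rintro ⟨a, b⟩ ⟨a', b'⟩ h
    simpa using h
  have hcard : Nat.card (Memory c) ≤ c * 7 := by
    refine (Nat.card_le_card_of_injective _ hinj).trans_eq ?_
    rw [Nat.card_prod, Nat.card_eq_fintype_card, Nat.card_eq_fintype_card, Fintype.card_fin]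
    rfl
  have hpos : 0 < Nat.card (Memory c) :=
    have : Nonempty (Memory c) := ⟨⟨⟨0, by omega⟩, .line13⟩⟩
    Nat.card_pos
  have hpow : c * 7 ≤ c ^ 4 := by
    have : 2 ^ 3 ≤ c ^ 3 := Nat.pow_le_pow_left hc 3
    rw [pow_succ' c 3]
    exact Nat.mul_le_mul_left c (by omega)
  have h1 : Real.logb 2 (Nat.card (Memory c)) ≤ Real.logb 2 ((c : ℝ) ^ 4) :=
    Real.logb_le_logb_of_le (by norm_num) (by exact_mod_cast hpos)
      (by exact_mod_cast hcard.trans hpow)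
  rw [Real.logb_pow] at h1
  have h2 : 0 ≤ Real.logb 2 c :=
    Real.logb_nonneg (by norm_num) (by exact_mod_cast (by omega : 1 ≤ c))
  refine h1.trans ?_
  push_cast
  linarith

theorem whiteboardMemory_le (hc : 2 ≤ c) (d : ℕ) :
    (algorithm c hc).whiteboardMemory d ≤ 200 * (Real.logb 2 c + Real.logb 2 d) := by
  have hinj : Function.Injective fun s : Board c d => (s.parent, s.color) := by
    rintro ⟨a, b⟩ ⟨a', b'⟩ h
    simpa using h
  have hcard : Nat.card (Board c d) ≤ (d + 1) * c := by
    refine (Nat.card_le_card_of_injective _ hinj).trans_eq ?_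
    rw [Nat.card_prod, Nat.card_eq_fintype_card, Nat.card_eq_fintype_card, Fintype.card_fin,
      Fintype.card_option, Fintype.card_fin]
  have hpos : 0 < Nat.card (Board c d) :=
    have : Nonempty (Board c d) := ⟨⟨none, ⟨0, by omega⟩⟩⟩
    Nat.card_pos
  have hc0 : (c : ℝ) ≠ 0 := by exact_mod_cast (by omega : c ≠ 0)
  have h2 : 0 ≤ Real.logb 2 c :=
    Real.logb_nonneg (by norm_num) (by exact_mod_cast (by omega : 1 ≤ c))
  change Real.logb 2 (Nat.card (Board c d)) ≤ _
  -- Degree `0` is the graph with one node, where `Real.logb 2 0 = 0` and the colour is the only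
  -- information.
  rcases Nat.eq_zero_or_pos d with rfl | hd
  · have h1 : Real.logb 2 (Nat.card (Board c 0)) ≤ Real.logb 2 c :=
      Real.logb_le_logb_of_le (by norm_num) (by exact_mod_cast hpos)
        (by exact_mod_cast hcard.trans_eq (by omega))
    simp only [Nat.cast_zero, Real.logb_zero, add_zero]
    linarith
  · have hle : (d + 1) * c ≤ c ^ 2 * d := by nlinarith [Nat.mul_le_mul hd hc]
    have h1 : Real.logb 2 (Nat.card (Board c d)) ≤ Real.logb 2 ((c : ℝ) ^ 2 * d) :=
      Real.logb_le_logb_of_le (by norm_num) (by exact_mod_cast hpos)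
        (by exact_mod_cast hcard.trans hle)
    have hd0 : (d : ℝ) ≠ 0 := by exact_mod_cast hd.ne'
    rw [Real.logb_mul (pow_ne_zero _ hc0) hd0, Real.logb_pow] at h1
    have h3 : 0 ≤ Real.logb 2 d := Real.logb_nonneg (by norm_num) (by exact_mod_cast hd)
    refine h1.trans ?_
    push_cast
    linarith

end Pran

theorem theorem1 :
    ∃ C : ℕ, ∀ (c : ℕ) (hc : 2 ≤ c),
      -- self-stabilizing exploration on all simple, undirected, connected port-labelled graphs
      (Pran.algorithm c hc).IsSelfStabilizingExploration (Set.univ : Set PortGraph.{u}) ∧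
      -- the cover time is `O(mD)` with probability 1
      (∀ (G : PortGraph.{u}) (γ : AgentAlgorithm.Config (Pran.algorithm c hc) G),
        ∀ᵐ ω ∂(AgentAlgorithm.execution γ),
          AgentAlgorithm.coverTime ω ≤ ((C * (G.numEdges * G.diam) : ℕ) : ℕ∞)) ∧
      -- the expected cover time
      (∀ (G : PortGraph.{u}) (γ : AgentAlgorithm.Config (Pran.algorithm c hc) G),
        AgentAlgorithm.expectedCoverTime γ ≤ ENNReal.ofReal
          (C * min
            (G.numEdges *
              (⌈(G.numNodes : ℝ) / max ((c : ℝ) - G.numNodes) ((G.numNodes : ℝ) / G.diam)⌉ : ℝ))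
            (G.numEdges * (⌈(G.diam : ℝ) / c⌉ : ℝ) * Real.log G.numNodes))) ∧
      -- the agent memory space
      (Pran.algorithm c hc).agentMemory ≤ C * Real.logb 2 c ∧
      -- the whiteboard memory space
      (∀ (G : PortGraph.{u}) (v : G.V),
        (Pran.algorithm c hc).whiteboardMemory (G.deg v) ≤
          C * (Real.logb 2 c + Real.logb 2 (G.deg v))) := by
  -- The constant is generous; the logarithmic bound is the most demanding, as its additive terms
  -- are absorbed by `log n ≥ log 2`.
  refine ⟨200, fun c hc => ⟨?_, ?_, ?_, ?_, ?_⟩⟩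
  · intro G _ γ
    filter_upwards [Pran.ae_coverTime_le_mul_diam γ] with ω hω v
    have hv := Finset.mem_univ v
    rw [← AgentAlgorithm.coverTime_le_iff.1 hω, AgentAlgorithm.mem_visited] at hv
    obtain ⟨s, -, hs⟩ := hv
    exact ⟨s, hs⟩
  · intro G γ
    filter_upwards [Pran.ae_coverTime_le_mul_diam γ] with ω hω
    exact hω.trans (Nat.cast_le.2 (Nat.mul_le_mul_right _ (by norm_num)))
  · intro G γ
    rw [mul_min_of_nonneg _ _ (Nat.cast_nonneg 200), ENNReal.ofReal_min]
    exact le_min (by exact_mod_cast Pran.expectedCoverTime_le_unused γ)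
      (by exact_mod_cast Pran.expectedCoverTime_le_log γ)
  · exact_mod_cast Pran.agentMemory_le hc
  · intro G v
    exact_mod_cast Pran.whiteboardMemory_le hc (G.deg v)
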